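/- Let $\gamma$ be a $C^2$-smooth simple closed convex curve of positive curvature in $\mathbb R^2$, parametrized counterclockwise by arc length $s$ and symmetric with respect to the origin. Let $P$ be its perimeter, $A$ the area of the domain it bounds, and $h(\psi)=\max_{s}\langle\gamma(s),n_\psi\rangle$, $n_\psi=(\cos\psi,\sin\psi)$, its support function. Consider the phase cylinder $\mathbf A=\{(s,\delta): s\in\mathbb R/P\mathbb Z,\ 0<\delta<\pi\}$ of the billiard in $\gamma$, where $(s,\delta)$ stands for the oriented line which enters the table at $\gamma(s)$ and makes the angle $\delta$ with $\gamma'(s)$. Let $T:\mathbf A\to\mathbf A$ be the billiard map, let $\mu$ be its invariant measure $d\mu=\sin\delta\,ds\,d\delta$, and let $\psi=\psi(s)$ be the angle between the outer unit normal at $\gamma(s)$ and the horizontal. Suppose that $T$ has a continuous rotational invariant curve $\alpha\subset\mathbf A$ (a simple closed curve winding once around the cylinder) of rotation number $1/4$ which consists of $4$-periodic orbits of $T$. Let $\bar\alpha$ be the invariant curve formed by the lines of $\alpha$ with the reversed orientation (it has rotation number $3/4$), and let $\mathcal B\subset\mathbf A$ be the domain between $\alpha$ and $\bar\alpha$. Then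 $h$ is of class $C^2$, the function $h''(\psi)\sin\delta$ is $\mu$-integrable on $\mathcal B$, and $$ I:=\int_{\mathcal B} h''(\psi)\,\sin\delta\;d\mu\ \ \ge\ \ \frac38\,\bigl(P^2-4\pi A\bigr). $$ -/

import Mathlib

open MeasureTheory Set Filter Topology

noncomputable section

namespace Billiard

/-- `γ` is a counterclockwise arc-length parametrization, of class `C²`, of a simple closed convex
plane curve of positive curvature which is symmetric about the origin.  The Euclidean plane is `ℂ`.
Since `γ` has unit speed and is injective on one period, its least period `P` is the perimeter. -/
structure IsTable (γ : ℝ → ℂ) (P : ℝ) : Prop where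
  pos : 0 < P
  contDiff : ContDiff ℝ 2 γ
  periodic : Function.Periodic γ P
  simple : InjOn γ (Ico 0 P)
  unit_speed : ∀ s, ‖deriv γ s‖ = 1
  /-- The signed curvature `det (γ' s, γ'' s)` is positive. -/
  curvature_pos : ∀ s, 0 < ((starRingEnd ℂ) (deriv γ s) * deriv (deriv γ) s).im
  /-- The curve is the boundary of its convex hull. -/
  convex : frontier (convexHull ℝ (range γ)) = range γ
  symmetric : ∀ s, -γ s ∈ range γ

/-- The area of the domain bounded by the convex curve `γ`. -/
def area (γ : ℝ → ℂ) : ℝ := volume.real (convexHull ℝ (range γ))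

/-- The support function `h(ψ) = max ⟨γ, n_ψ⟩`, where `n_ψ = (cos ψ, sin ψ)`. -/
def supportFunction (γ : ℝ → ℂ) (ψ : ℝ) : ℝ :=
  ⨆ s : ℝ, inner ℝ (γ s) (Complex.exp (ψ * Complex.I))

/-- The angle `ψ` formed by the outer unit normal `-i γ'(s)` at `γ s` with the horizontal
(the choice modulo `2π` is immaterial, as `h` is `2π`-periodic). -/
def normalAngle (γ : ℝ → ℂ) (s : ℝ) : ℝ := Complex.arg (-Complex.I * deriv γ s)

/-! The phase cylinder of oriented lines meeting the table is described by its universal cover: the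
strip of pairs `(s, δ)` with `0 < δ < π`, where the pairs `(s, δ)` and `(s + P, δ)` represent the
same oriented line.  The line `(s, δ)` enters the table at `γ s` and has the direction
`exp (i δ) γ'(s)`, so that `δ` is its angle with the tangent.  Subsets of the cylinder are
described by their preimages in the strip. -/

/-- The graph of the billiard map `T`, lifted to the strip: the line `z = (s, δ)` runs from `γ s` to
`γ s₁`, makes the angle `δ` with `γ'(s)` and the angle `δ₁` with `γ'(s₁)`, and is reflected to the
line `z₁ = (s₁, δ₁)`. The lift is the standard one, `s < s₁ < s + P`. -/
def Step (γ : ℝ → ℂ) (P : ℝ) (z z₁ : ℝ × ℝ) : Prop :=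
  z.2 ∈ Ioo 0 Real.pi ∧ z₁.2 ∈ Ioo 0 Real.pi ∧ z.1 < z₁.1 ∧ z₁.1 < z.1 + P ∧
  γ z₁.1 - γ z.1 =
    ‖γ z₁.1 - γ z.1‖ * (Complex.exp (z.2 * Complex.I) * deriv γ z.1) ∧
  γ z₁.1 - γ z.1 =
    ‖γ z₁.1 - γ z.1‖ * (Complex.exp (-(z₁.2 * Complex.I)) * deriv γ z₁.1)

/-- Lifts of full orbits of the billiard map. -/
def IsOrbit (γ : ℝ → ℂ) (P : ℝ) (z : ℤ → ℝ × ℝ) : Prop :=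
  ∀ n, Step γ P (z n) (z (n + 1))

/-- `α` is (the lift of) a continuous simple closed curve in the phase cylinder which winds once
around the cylinder. -/
def IsRotationalCurve (P : ℝ) (α : Set (ℝ × ℝ)) : Prop :=
  ∃ c : ℝ → ℝ × ℝ, Continuous c ∧ range c = α ∧ (∀ t, (c t).2 ∈ Ioo 0 Real.pi) ∧
    (∀ t, c (t + 1) = c t + (P, 0)) ∧
    (∀ t t' : ℝ, ∀ k : ℤ, c t' = c t + (k * P, 0) → t' = t + k)

/-- `T(α) = α`. -/
def IsInvariant (γ : ℝ → ℂ) (P : ℝ) (α : Set (ℝ × ℝ)) : Prop :=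
  ∀ z z₁, Step γ P z z₁ → (z ∈ α ↔ z₁ ∈ α)

/-- `α` consists of `N`-periodic orbits of the billiard map. -/
def ConsistsOfPeriodicOrbits (γ : ℝ → ℂ) (P : ℝ) (N : ℕ) (α : Set (ℝ × ℝ)) : Prop :=
  ∀ w ∈ α, ∃ z : ℤ → ℝ × ℝ, IsOrbit γ P z ∧ z 0 = w ∧ (∀ n, z n ∈ α) ∧
    ∃ k : ℤ, ∀ n, z (n + N) = z n + (k * P, 0)

/-- The orbits in `α` have rotation number `r`. -/
def HasRotationNumber (γ : ℝ → ℂ) (P : ℝ) (α : Set (ℝ × ℝ)) (r : ℝ) : Prop :=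
  ∀ z : ℤ → ℝ × ℝ, IsOrbit γ P z → z 0 ∈ α →
    Tendsto (fun n : ℕ => ((z n).1 - (z 0).1) / (n * P)) atTop (𝓝 r)

/-- The lines of `α` with the reversed orientation: if `T(s, δ) = (s₁, δ₁)`, then the reversal of
the line `(s, δ)` starts at `γ s₁` and makes the angle `π - δ₁` with `γ'(s₁)`. -/
def reversed (γ : ℝ → ℂ) (P : ℝ) (α : Set (ℝ × ℝ)) : Set (ℝ × ℝ) :=
  {w | ∃ z ∈ α, ∃ z₁, Step γ P z z₁ ∧ w = (z₁.1, Real.pi - z₁.2)}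

/-- The points that can be joined to the boundary component `δ = π` without meeting `α`. -/
def upperSide (α : Set (ℝ × ℝ)) : Set (ℝ × ℝ) :=
  {z | ∃ s, JoinedIn ((univ ×ˢ Ioc 0 Real.pi) \ α) z (s, Real.pi)}

/-- The points that can be joined to the boundary component `δ = 0` without meeting `α`. -/
def lowerSide (α : Set (ℝ × ℝ)) : Set (ℝ × ℝ) :=
  {z | ∃ s, JoinedIn ((univ ×ˢ Ico 0 Real.pi) \ α) z (s, 0)}

/-- The domain of the phase cylinder between `α` and the reversed curve. -/
def regionBetween (γ : ℝ → ℂ) (P : ℝ) (α : Set (ℝ × ℝ)) : Set (ℝ × ℝ) :=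
  upperSide α ∩ lowerSide (reversed γ P α)

/-- The invariant measure `dμ = |d(cos δ) ∧ ds| = sin δ ds dδ` of the phase cylinder, carried by the
fundamental domain `[0, P) × (0, π)`. -/
def invMeasure (P : ℝ) : Measure (ℝ × ℝ) :=
  (volume.restrict (Ico 0 P ×ˢ Ioo 0 Real.pi)).withDensity
    (fun z => ENNReal.ofReal (Real.sin z.2))

/-- The function `h''(ψ) sin δ` on the phase cylinder. -/
def integrand (γ : ℝ → ℂ) (z : ℝ × ℝ) : ℝ :=
  deriv (deriv (supportFunction γ)) (normalAngle γ z.1) * Real.sin z.2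

end Billiard

end

/-!
In terms of the support function `h`, the perimeter is `∫ h` and twice the area is `∫ h (h + h'')`,
where `h + h''` is the radius of curvature. The periodic orbits which form `α` never cross, so the
billiard map acts on the normal angles as a circle homeomorphism and `α` is a graph. A 4-periodic
orbit of rotation number `1/4` in a centrally symmetric table is a parallelogram, and its reflection
law forces consecutive tangent lines to be orthogonal, so that the vertices of the circumscribed
rectangles lie on a circle: `h(ψ)² + h(ψ + π/2)² = R²`, and `α` is given by `sin δ = h / R`.

Writing `h = R sin d`, the integral over the domain between the graphs of `d` and `π - d` becomes a
one-dimensional integral of an expression in `d`, `d'` and `d''`. As `d(x + π/2) = π/2 - d(x)`,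
after an integration by parts the contributions of `x` and `x + π/2` add up to at least
`(π/4 + 1/2) d''² - (π/2) d'²`, and Wirtinger's inequality applies because `d'` is antiperiodic. The
result is compared with the isoperimetric deficit by the Cauchy-Schwarz inequality for `∫ h`.
-/

noncomputable section

namespace Billiard

/-! ### The normal angle of a plane curve -/

/-- The signed curvature `det (γ', γ'')` of a curve of unit speed. -/
def curvature (γ : ℝ → ℂ) (s : ℝ) : ℝ :=
  ((starRingEnd ℂ) (deriv γ s) * deriv (deriv γ) s).im

/-- `ψ` is a differentiable determination of the angle of the unit normal `-i γ'` of a curve `γ` of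
unit speed. -/
structure IsNormalAngle (γ : ℝ → ℂ) (ψ : ℝ → ℝ) : Prop where
  hasDerivAt_curve : ∀ s, HasDerivAt γ (Complex.I * Complex.exp (ψ s * Complex.I)) s
  hasDerivAt : ∀ s, HasDerivAt ψ (curvature γ s) s

section Deriv

variable {E : Type*} [NormedAddCommGroup E] [NormedSpace ℝ E] {f : ℝ → E}

theorem contDiff_one_deriv (hf : ContDiff ℝ 2 f) : ContDiff ℝ 1 (deriv f) :=
  ContDiff.deriv' (by rwa [one_add_one_eq_two])

theorem deriv_periodic {c : ℝ} (hf : Function.Periodic f c) : Function.Periodic (deriv f) c :=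
  fun x => by
    rw [← deriv_comp_add_const]
    exact congrArg (deriv · x) (funext hf)

theorem deriv_antiperiodic {c : ℝ} (hf : Function.Antiperiodic f c) :
    Function.Antiperiodic (deriv f) c := fun x => by
  rw [← deriv_comp_add_const, funext hf, deriv.fun_neg]

end Deriv

section UnitSpeed

variable {γ : ℝ → ℂ}

theorem continuous_curvature (hγ : ContDiff ℝ 2 γ) : Continuous (curvature γ) := by
  have h' := contDiff_one_deriv hγ
  exact Complex.continuous_im.comp
    ((Complex.continuous_conj.comp h'.continuous).mul (h'.continuous_deriv le_rfl))

theorem deriv_deriv_eq_curvature_mul (hγ : ContDiff ℝ 2 γ) (hunit : ∀ s, ‖deriv γ s‖ = 1) (s : ℝ) :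
    deriv (deriv γ) s = curvature γ s * (Complex.I * deriv γ s) := by
  have horth : ((starRingEnd ℂ) (deriv γ s) * deriv (deriv γ) s).re = 0 := by
    have h := ((contDiff_one_deriv hγ).differentiable one_ne_zero s).hasDerivAt.norm_sq
    simp only [hunit, one_pow, Complex.inner] at h
    rw [mul_comm]
    linarith [h.unique (hasDerivAt_const s 1)]
  have hcurv : (starRingEnd ℂ) (deriv γ s) * deriv (deriv γ) s = curvature γ s * Complex.I := by
    apply Complex.ext
    · simpa using horth
    · simp [curvature]
  calc deriv (deriv γ) s
      = deriv γ s * (starRingEnd ℂ) (deriv γ s) * deriv (deriv γ) s := by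
        rw [Complex.mul_conj, Complex.normSq_eq_norm_sq, hunit]; simp
    _ = curvature γ s * (Complex.I * deriv γ s) := by rw [mul_assoc, hcurv]; ring

theorem exists_isNormalAngle (hγ : ContDiff ℝ 2 γ) (hunit : ∀ s, ‖deriv γ s‖ = 1) :
    ∃ ψ, IsNormalAngle γ ψ := by
  let ψ : ℝ → ℝ := fun s => Complex.arg (-Complex.I * deriv γ 0) + ∫ u in 0..s, curvature γ u
  have hψ : ∀ s, HasDerivAt ψ (curvature γ s) s := fun s =>
    ((continuous_curvature hγ).integral_hasStrictDerivAt 0 s).hasDerivAt.const_add _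
  have hconst : ∀ s, HasDerivAt (fun s => Complex.exp (-(ψ s * Complex.I)) * deriv γ s) 0 s := by
    intro s
    have h := (((hψ s).ofReal_comp.mul_const Complex.I).fun_neg.cexp).fun_mul
      ((contDiff_one_deriv hγ).differentiable one_ne_zero s).hasDerivAt
    refine h.congr_deriv ?_
    rw [deriv_deriv_eq_curvature_mul hγ hunit s]
    ring
  have h₀ : deriv γ 0 = Complex.exp (ψ 0 * Complex.I) * Complex.I := by
    have h := Complex.norm_mul_exp_arg_mul_I (-Complex.I * deriv γ 0)
    simp only [norm_mul, norm_neg, Complex.norm_I, hunit, one_mul, Complex.ofReal_one] at h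
    simp only [ψ, intervalIntegral.integral_same, add_zero, h]
    linear_combination deriv γ 0 * Complex.I_sq
  refine ⟨ψ, fun s => ?_, hψ⟩
  have h := is_const_of_deriv_eq_zero (fun s => (hconst s).differentiableAt)
    (fun s => (hconst s).deriv) s 0
  rw [h₀, ← mul_assoc, ← Complex.exp_add, neg_add_cancel, Complex.exp_zero, one_mul,
    Complex.exp_neg, inv_mul_eq_iff_eq_mul₀ (Complex.exp_ne_zero _), mul_comm] at h
  exact h ▸ (hγ.differentiable two_ne_zero s).hasDerivAt

end UnitSpeed

/-! ### Heights -/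

/-- The height of a point in the direction `n_x = (cos x, sin x)`. -/
def height (x : ℝ) : ℂ →L[ℝ] ℝ := Real.cos x • Complex.reCLM + Real.sin x • Complex.imCLM

theorem height_apply (x : ℝ) (z : ℂ) : height x z = Real.cos x * z.re + Real.sin x * z.im := by
  simp [height]

theorem height_eq_inner (x : ℝ) (z : ℂ) : height x z = inner ℝ z (Complex.exp (x * Complex.I)) := by
  simp [height_apply, Complex.inner, Complex.exp_ofReal_mul_I_re, Complex.exp_ofReal_mul_I_im]

theorem height_I_mul_exp (x y : ℝ) :
    height x (Complex.I * Complex.exp (y * Complex.I)) = Real.sin (x - y) := by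
  simp [height_apply, Complex.exp_ofReal_mul_I_re, Complex.exp_ofReal_mul_I_im, Real.sin_sub]
  ring

theorem height_add_pi (x : ℝ) (z : ℂ) : height (x + Real.pi) z = -height x z := by
  simp [height_apply]; ring

theorem hasDerivAt_height {c : ℝ → ℂ} {c' : ℂ} {x : ℝ} (hc : HasDerivAt c c' x) (a : ℝ) :
    HasDerivAt (fun x => height (x + a) (c x)) (height (x + a + Real.pi / 2) (c x) +
      height (x + a) c') x := by
  have ha := (hasDerivAt_id x).add_const a
  have hre := Complex.reCLM.hasFDerivAt.comp_hasDerivAt x hc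
  have him := Complex.imCLM.hasFDerivAt.comp_hasDerivAt x hc
  simp only [height_apply, Real.cos_add_pi_div_two, Real.sin_add_pi_div_two]
  refine ((ha.cos.fun_mul hre).fun_add (ha.sin.fun_mul him)).congr_deriv ?_
  simp only [Function.comp_apply, id_eq, Complex.reCLM_apply, Complex.imCLM_apply]
  ring

theorem height_frame (x : ℝ) (z : ℂ) :
    z = (height x z + height (x + Real.pi / 2) z * Complex.I) * Complex.exp (x * Complex.I) := by
  have h := Real.sin_sq_add_cos_sq x
  apply Complex.ext <;>
    simp only [height_apply, Real.cos_add_pi_div_two, Real.sin_add_pi_div_two, Complex.mul_re,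
      Complex.mul_im, Complex.add_re, Complex.add_im, Complex.ofReal_re, Complex.ofReal_im,
      Complex.I_re, Complex.I_im, Complex.exp_ofReal_mul_I_re, Complex.exp_ofReal_mul_I_im]
  · linear_combination -z.re * h
  · linear_combination -z.im * h

theorem eq_smul_height {f : ℂ →L[ℝ] ℝ} {x : ℝ}
    (hf : f (Complex.I * Complex.exp (x * Complex.I)) = 0) :
    f = f (Complex.exp (x * Complex.I)) • height x := by
  ext1 z
  have hz : z = height x z • Complex.exp (x * Complex.I)
      + height (x + Real.pi / 2) z • (Complex.I * Complex.exp (x * Complex.I)) := by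
    conv_lhs => rw [height_frame x z]
    simp only [Complex.real_smul]
    ring
  conv_lhs => rw [hz]
  rw [map_add, map_smul, map_smul, hf]
  simp [mul_comm]

namespace IsNormalAngle

variable {γ : ℝ → ℂ} {ψ : ℝ → ℝ}

theorem hasDerivAt_height_comp (hψ : IsNormalAngle γ ψ) (x s : ℝ) :
    HasDerivAt (fun s => height x (γ s)) (Real.sin (x - ψ s)) s := by
  rw [← height_I_mul_exp]
  exact (height x).hasFDerivAt.comp_hasDerivAt s (hψ.hasDerivAt_curve s)

theorem continuous_curve (hψ : IsNormalAngle γ ψ) : Continuous γ :=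
  continuous_iff_continuousAt.2 fun s => (hψ.hasDerivAt_curve s).continuousAt

theorem continuous (hψ : IsNormalAngle γ ψ) : Continuous ψ :=
  continuous_iff_continuousAt.2 fun s => (hψ.hasDerivAt s).continuousAt

theorem strictMono (hψ : IsNormalAngle γ ψ) (hpos : ∀ s, 0 < curvature γ s) : StrictMono ψ :=
  strictMono_of_deriv_pos fun s => (hψ.hasDerivAt s).deriv ▸ hpos s

theorem strictAntiOn_height_comp (hψ : IsNormalAngle γ ψ) (hmono : StrictMono ψ) {s t : ℝ}
    (hst : ψ t ≤ ψ s + Real.pi) : StrictAntiOn (fun u => height (ψ s) (γ u)) (Icc s t) := by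
  refine strictAntiOn_of_deriv_neg (convex_Icc s t)
    (((height (ψ s)).continuous.comp hψ.continuous_curve).continuousOn) fun u hu => ?_
  rw [interior_Icc] at hu
  rw [(hψ.hasDerivAt_height_comp (ψ s) u).deriv]
  exact Real.sin_neg_of_neg_of_neg_pi_lt (by linarith [hmono hu.1]) (by linarith [hmono hu.2])

end IsNormalAngle

/-! ### Supporting lines -/

theorem map_add_zsmul_of_map_add {G H : Type*} [AddGroup G] [AddGroup H] {f : G → H} {a : G}
    {b : H} (hab : ∀ x, f (x + a) = f x + b) (x : G) (n : ℤ) : f (x + n • a) = f x + n • b :=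
  AddConstMapClass.map_add_zsmul (AddConstMap.mk f hab) x n

theorem surjective_of_add_eq {f : ℝ → ℝ} (hf : Continuous f) {a b : ℝ} (ha : 0 < a) (hb : 0 < b)
    (hab : ∀ x, f (x + a) = f x + b) : Function.Surjective f := by
  intro x
  obtain ⟨m, hm, -⟩ := existsUnique_add_zsmul_mem_Ico hb x (f 0)
  rw [← hab] at hm
  obtain ⟨t, -, ht⟩ := intermediate_value_Ico (by linarith) hf.continuousOn hm
  refine ⟨t + (-m) • a, ?_⟩
  rw [map_add_zsmul_of_map_add hab, ht, neg_zsmul, add_neg_cancel_right]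

theorem exists_eq_add_zsmul_of_injOn_Ico {β : Type*} {f : ℝ → β} {P : ℝ} (hP : 0 < P)
    (hper : Function.Periodic f P) (hinj : InjOn f (Ico 0 P)) {s t : ℝ} (h : f s = f t) :
    ∃ n : ℤ, s = t + n • P := by
  have hmod : ∀ u, f (toIcoMod hP 0 u) = f u := fun u => hper.sub_zsmul_eq _
  have hmem : ∀ u, toIcoMod hP 0 u ∈ Ico 0 P := fun u => by
    simpa only [zero_add] using toIcoMod_mem_Ico hP 0 u
  have heq := hinj (hmem s) (hmem t) (by rw [hmod, hmod, h])
  refine ⟨toIcoDiv hP 0 s - toIcoDiv hP 0 t, ?_⟩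
  rw [toIcoMod, toIcoMod] at heq
  rw [sub_zsmul]
  linarith

namespace IsNormalAngle

variable {γ : ℝ → ℂ} {ψ : ℝ → ℝ}

theorem exists_gt_angle_lt (hψ : IsNormalAngle γ ψ) (s : ℝ) : ∃ t > s, ψ t < ψ s + Real.pi := by
  have h : ∀ᶠ t in 𝓝[>] s, ψ t < ψ s + Real.pi :=
    (hψ.continuous.tendsto s).mono_left nhdsWithin_le_nhds |>.eventually_lt_const
      (by linarith [Real.pi_pos])
  obtain ⟨t, ht, hst⟩ := (h.and self_mem_nhdsWithin).exists
  exact ⟨t, hst, ht⟩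

theorem eq_zero_of_comp_const (hψ : IsNormalAngle γ ψ) (hmono : StrictMono ψ) {f : ℂ →L[ℝ] ℝ}
    (hf : ∀ s, f (γ s) = f (γ 0)) : f = 0 := by
  have hnormal : ∀ s, f (Complex.I * Complex.exp (ψ s * Complex.I)) = 0 := fun s => by
    have h := f.hasFDerivAt.comp_hasDerivAt s (hψ.hasDerivAt_curve s)
    rw [show f ∘ γ = fun _ => f (γ 0) from funext hf] at h
    exact h.unique (hasDerivAt_const s _)
  obtain ⟨t, ht₀, htπ⟩ := hψ.exists_gt_angle_lt 0
  have hf₀ := eq_smul_height (hnormal 0)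
  have ht := hnormal t
  rw [hf₀, smul_apply, height_I_mul_exp, smul_eq_mul, mul_eq_zero] at ht
  have hsin : Real.sin (ψ 0 - ψ t) < 0 :=
    Real.sin_neg_of_neg_of_neg_pi_lt (by linarith [hmono ht₀]) (by linarith)
  rw [hf₀, ht.resolve_right hsin.ne, zero_smul]

theorem interior_convexHull_nonempty (hψ : IsNormalAngle γ ψ) (hmono : StrictMono ψ) :
    (interior (convexHull ℝ (range γ))).Nonempty := by
  rw [(convex_convexHull ℝ _).interior_nonempty_iff_affineSpan_eq_top, affineSpan_convexHull]
  by_contra hne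
  have hmem : ∀ s, γ s ∈ affineSpan ℝ (range γ) := fun s =>
    subset_affineSpan ℝ _ (mem_range_self s)
  have hdir : (affineSpan ℝ (range γ)).direction < ⊤ :=
    lt_top_iff_ne_top.2 fun h =>
      hne ((AffineSubspace.direction_eq_top_iff_of_nonempty ⟨γ 0, hmem 0⟩).1 h)
  obtain ⟨f, hf_ne, hf_ker⟩ := Submodule.exists_le_ker_of_lt_top _ hdir
  have hf : ∀ s, f (γ s) = f (γ 0) := fun s => by
    have h : γ s - γ 0 ∈ LinearMap.ker f :=
      hf_ker (AffineSubspace.vsub_mem_direction (hmem s) (hmem 0))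
    rwa [LinearMap.mem_ker, map_sub, sub_eq_zero] at h
  have hzero := hψ.eq_zero_of_comp_const hmono (f := LinearMap.toContinuousLinearMap f) hf
  exact hf_ne (by simpa using hzero)

theorem height_le (hψ : IsNormalAngle γ ψ) (hmono : StrictMono ψ) {s : ℝ}
    (hs : γ s ∈ frontier (convexHull ℝ (range γ))) (t : ℝ) :
    height (ψ s) (γ t) ≤ height (ψ s) (γ s) := by
  obtain ⟨f, hf_ne, hf⟩ := geometric_hahn_banach_of_nonempty_interior_point
    (convex_convexHull ℝ _) hs.2 (hψ.interior_convexHull_nonempty hmono)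
  replace hf : ∀ t, f (γ t) ≤ f (γ s) := fun t => hf _ (subset_convexHull ℝ _ (mem_range_self t))
  have hnormal : f (Complex.I * Complex.exp (ψ s * Complex.I)) = 0 :=
    IsLocalMax.hasDerivAt_eq_zero (Eventually.of_forall hf)
      (f.hasFDerivAt.comp_hasDerivAt s (hψ.hasDerivAt_curve s))
  obtain ⟨c, hc⟩ : ∃ c, f = c • height (ψ s) := ⟨_, eq_smul_height hnormal⟩
  subst hc
  simp only [smul_apply, smul_eq_mul] at hf
  -- The height strictly decreases after `s`, so a negative `c` would contradict the maximality.
  obtain ⟨u, hsu, hu⟩ := hψ.exists_gt_angle_lt s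
  have hdesc := hψ.strictAntiOn_height_comp hmono hu.le (left_mem_Icc.2 hsu.le)
    (right_mem_Icc.2 hsu.le) hsu
  have hc_ne : c ≠ 0 := fun h => hf_ne (by simp [h])
  have hc_nonneg : 0 ≤ c := by
    by_contra! hneg
    exact absurd (hf u) (not_le.2 (mul_lt_mul_of_neg_left hdesc hneg))
  exact le_of_mul_le_mul_left (hf t) (hc_nonneg.lt_of_ne' hc_ne)

theorem exists_turning (hψ : IsNormalAngle γ ψ) {P : ℝ} (hper : Function.Periodic γ P) :
    ∃ k : ℤ, ∀ s, ψ (s + P) = ψ s + k * (2 * Real.pi) := by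
  have hcurv : ∀ s, curvature γ (s + P) = curvature γ s := fun s => by
    rw [curvature, curvature, deriv_periodic hper, deriv_periodic (deriv_periodic hper)]
  have hexp : Complex.exp (ψ (0 + P) * Complex.I) = Complex.exp (ψ 0 * Complex.I) := by
    have h := deriv_periodic hper 0
    rw [(hψ.hasDerivAt_curve _).deriv, (hψ.hasDerivAt_curve _).deriv] at h
    exact mul_left_cancel₀ Complex.I_ne_zero h
  obtain ⟨k, hk⟩ := Complex.exp_eq_exp_iff_exists_int.1 hexp
  have hk' : ψ (0 + P) = ψ 0 + k * (2 * Real.pi) := by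
    have h : (ψ (0 + P) : ℂ) * Complex.I = ((ψ 0 + k * (2 * Real.pi) : ℝ) : ℂ) * Complex.I := by
      rw [hk]; push_cast; ring
    exact_mod_cast mul_right_cancel₀ Complex.I_ne_zero h
  have hconst : ∀ s, HasDerivAt (fun s => ψ (s + P) - ψ s) 0 s := fun s => by
    have h := ((hψ.hasDerivAt (s + P)).comp_add_const s P).fun_sub (hψ.hasDerivAt s)
    rwa [hcurv, sub_self] at h
  refine ⟨k, fun s => ?_⟩
  have h := is_const_of_deriv_eq_zero (fun s => (hconst s).differentiableAt)
    (fun s => (hconst s).deriv) s 0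
  linarith

end IsNormalAngle

/-! ### The support function of a table -/

/-- The point with support data `h x`, `h' x`: the envelope of the lines of height `h x` in the
direction `n_x`. -/
def supportCurve (h : ℝ → ℝ) (x : ℝ) : ℂ :=
  (h x + deriv h x * Complex.I) * Complex.exp (x * Complex.I)

/-- `h` is the support function of a centrally symmetric oval with finite radius of curvature
`h + h''`. -/
structure IsOvalSupport (h : ℝ → ℝ) : Prop where
  contDiff : ContDiff ℝ 2 h
  pos : ∀ x, 0 < h x
  periodic : Function.Periodic h Real.pi
  radius_pos : ∀ x, 0 < h x + deriv (deriv h) x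

theorem IsTable.exists_isNormalAngle {γ : ℝ → ℂ} {P : ℝ} (hγ : IsTable γ P) :
    ∃ ψ : ℝ ≃o ℝ, IsNormalAngle γ ψ := by
  obtain ⟨ψ, hψ⟩ := Billiard.exists_isNormalAngle hγ.contDiff hγ.unit_speed
  have hmono := hψ.strictMono hγ.curvature_pos
  obtain ⟨k, hk⟩ := hψ.exists_turning hγ.periodic
  have hpos : 0 < k * (2 * Real.pi) := by
    linarith [hk 0, hmono (show (0 : ℝ) < 0 + P by linarith [hγ.pos])]
  exact ⟨hmono.orderIsoOfSurjective ψ (surjective_of_add_eq hψ.continuous hγ.pos hpos hk), hψ⟩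

section Table

variable {γ : ℝ → ℂ} {P : ℝ} {ψ : ℝ ≃o ℝ}

theorem IsTable.supportFunction_apply (hγ : IsTable γ P) (hψ : IsNormalAngle γ ψ) (s : ℝ) :
    supportFunction γ (ψ s) = height (ψ s) (γ s) := by
  have hle : ∀ t, height (ψ s) (γ t) ≤ height (ψ s) (γ s) :=
    hψ.height_le ψ.strictMono (hγ.convex.ge (mem_range_self s))
  simp only [supportFunction, ← height_eq_inner]
  exact le_antisymm (ciSup_le hle)
    (le_ciSup (f := fun t => height (ψ s) (γ t)) ⟨_, forall_mem_range.2 hle⟩ s)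

theorem IsTable.height_le_supportFunction (hγ : IsTable γ P) (hψ : IsNormalAngle γ ψ) (x t : ℝ) :
    height x (γ t) ≤ supportFunction γ x := by
  rw [← ψ.apply_symm_apply x, hγ.supportFunction_apply hψ]
  exact hψ.height_le ψ.strictMono (hγ.convex.ge (mem_range_self _)) t

theorem IsTable.hasDerivAt_angle_symm (hγ : IsTable γ P) (hψ : IsNormalAngle γ ψ) (x : ℝ) :
    HasDerivAt ψ.symm (curvature γ (ψ.symm x))⁻¹ x :=
  (hψ.hasDerivAt _).of_local_left_inverse ψ.symm.continuous.continuousAt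
    (hγ.curvature_pos _).ne' (Eventually.of_forall ψ.apply_symm_apply)

theorem IsTable.hasDerivAt_height_angle_symm (hγ : IsTable γ P) (hψ : IsNormalAngle γ ψ)
    (a x : ℝ) :
    HasDerivAt (fun x => height (x + a) (γ (ψ.symm x)))
      (height (x + a + Real.pi / 2) (γ (ψ.symm x)) +
        (curvature γ (ψ.symm x))⁻¹ * Real.sin a) x := by
  have h := (hψ.hasDerivAt_curve (ψ.symm x)).scomp x (hγ.hasDerivAt_angle_symm hψ x)
  refine (hasDerivAt_height h a).congr_deriv ?_
  rw [map_smul, height_I_mul_exp, ψ.apply_symm_apply, add_sub_cancel_left]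
  rfl

theorem IsTable.hasDerivAt_supportFunction (hγ : IsTable γ P) (hψ : IsNormalAngle γ ψ) (x : ℝ) :
    HasDerivAt (supportFunction γ) (height (x + Real.pi / 2) (γ (ψ.symm x))) x := by
  have h : supportFunction γ = fun x => height (x + 0) (γ (ψ.symm x)) := funext fun x => by
    simpa only [ψ.apply_symm_apply, add_zero] using hγ.supportFunction_apply hψ (ψ.symm x)
  rw [h]
  simpa using hγ.hasDerivAt_height_angle_symm hψ 0 x

theorem IsTable.hasDerivAt_deriv_supportFunction (hγ : IsTable γ P) (hψ : IsNormalAngle γ ψ)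
    (x : ℝ) :
    HasDerivAt (deriv (supportFunction γ))
      ((curvature γ (ψ.symm x))⁻¹ - supportFunction γ x) x := by
  have h := hγ.hasDerivAt_height_angle_symm hψ (Real.pi / 2) x
  rw [funext fun x => (hγ.hasDerivAt_supportFunction hψ x).deriv]
  refine h.congr_deriv ?_
  have h₀ := hγ.supportFunction_apply hψ (ψ.symm x)
  rw [ψ.apply_symm_apply] at h₀
  rw [add_assoc, add_halves, height_add_pi, ← h₀, Real.sin_pi_div_two]
  ring

theorem IsTable.curve_eq_supportCurve (hγ : IsTable γ P) (hψ : IsNormalAngle γ ψ) (s : ℝ) :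
    γ s = supportCurve (supportFunction γ) (ψ s) := by
  rw [supportCurve, (hγ.hasDerivAt_supportFunction hψ _).deriv, hγ.supportFunction_apply hψ,
    ψ.symm_apply_apply]
  exact height_frame _ _

theorem IsTable.inv_curvature_eq (hγ : IsTable γ P) (hψ : IsNormalAngle γ ψ) (x : ℝ) :
    (curvature γ (ψ.symm x))⁻¹ = supportFunction γ x + deriv (deriv (supportFunction γ)) x := by
  rw [(hγ.hasDerivAt_deriv_supportFunction hψ x).deriv]
  ring

theorem IsTable.contDiff_supportFunction (hγ : IsTable γ P) : ContDiff ℝ 2 (supportFunction γ) := by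
  obtain ⟨ψ, hψ⟩ := hγ.exists_isNormalAngle
  have h₁ : Differentiable ℝ (supportFunction γ) := fun x =>
    (hγ.hasDerivAt_supportFunction hψ x).differentiableAt
  have h₂ : Differentiable ℝ (deriv (supportFunction γ)) := fun x =>
    (hγ.hasDerivAt_deriv_supportFunction hψ x).differentiableAt
  have h₃ : Continuous (deriv (deriv (supportFunction γ))) := by
    rw [funext fun x => (hγ.hasDerivAt_deriv_supportFunction hψ x).deriv]
    exact (((continuous_curvature hγ.contDiff).comp ψ.symm.continuous).inv₀
      fun x => (hγ.curvature_pos _).ne').sub h₁.continuous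
  rw [← one_add_one_eq_two, contDiff_succ_iff_deriv]
  exact ⟨h₁, by simp, contDiff_one_iff_deriv.2 ⟨h₂, h₃⟩⟩

theorem IsTable.supportFunction_periodic_pi (hγ : IsTable γ P) (hψ : IsNormalAngle γ ψ) :
    Function.Periodic (supportFunction γ) Real.pi := by
  have hle : ∀ x, supportFunction γ x ≤ supportFunction γ (x + Real.pi) := fun x => by
    obtain ⟨t, ht⟩ := hγ.symmetric (ψ.symm x)
    rw [← ψ.apply_symm_apply x, hγ.supportFunction_apply hψ]
    calc height (ψ (ψ.symm x)) (γ (ψ.symm x))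
        = height (ψ (ψ.symm x) + Real.pi) (γ t) := by rw [height_add_pi, ht, map_neg, neg_neg]
      _ ≤ supportFunction γ (ψ (ψ.symm x) + Real.pi) := hγ.height_le_supportFunction hψ _ t
  have htwo : supportFunction γ = fun x => supportFunction γ (x + Real.pi + Real.pi) := by
    funext x
    simp only [supportFunction, ← height_eq_inner, height_add_pi, neg_neg]
  exact fun x => le_antisymm ((hle (x + Real.pi)).trans (congrFun htwo x).ge) (hle x)

theorem supportCurve_periodic_two_pi {h : ℝ → ℝ} (hh : Function.Periodic h (2 * Real.pi)) :
    Function.Periodic (supportCurve h) (2 * Real.pi) := fun x => by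
  simp only [supportCurve, hh x, deriv_periodic hh x, Complex.ofReal_add, add_mul, Complex.exp_add]
  simp [Complex.exp_two_pi_mul_I]

/-- A turning number `k > 1` would make the curve, which is a function of the normal direction,
return before the end of its period. -/
theorem IsTable.angle_add_period (hγ : IsTable γ P) (hψ : IsNormalAngle γ ψ) (s : ℝ) :
    ψ (s + P) = ψ s + 2 * Real.pi := by
  have hper := (hγ.supportFunction_periodic_pi hψ).nat_mul 2
  obtain ⟨k, hk⟩ := hψ.exists_turning hγ.periodic
  obtain ⟨n, hn⟩ := exists_eq_add_zsmul_of_injOn_Ico hγ.pos hγ.periodic hγ.simple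
    (s := ψ.symm (ψ s + 2 * Real.pi)) (t := s) (by
      rw [hγ.curve_eq_supportCurve hψ, ψ.apply_symm_apply, hγ.curve_eq_supportCurve hψ s]
      exact supportCurve_periodic_two_pi (by exact_mod_cast hper) _)
  have hnk : ψ s + 2 * Real.pi = ψ s + (n * k : ℤ) * (2 * Real.pi) := by
    rw [← ψ.apply_symm_apply (ψ s + 2 * Real.pi), hn,
      map_add_zsmul_of_map_add hk]
    simp [mul_assoc]
  have hnk' : n * k = 1 := by
    have h : (1 : ℝ) * (2 * Real.pi) = (n * k : ℤ) * (2 * Real.pi) := by linarith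
    exact_mod_cast (mul_right_cancel₀ Real.two_pi_pos.ne' h).symm
  have hk_pos : 0 < k * (2 * Real.pi) := by
    linarith [hk 0, ψ.strictMono (show (0 : ℝ) < 0 + P by linarith [hγ.pos])]
  have hk_pos' : (0 : ℤ) < k := by exact_mod_cast pos_of_mul_pos_left hk_pos Real.two_pi_pos.le
  have hk_one : k = 1 := by
    rcases Int.isUnit_iff.1 (IsUnit.of_mul_eq_one_right n hnk') with h | h <;> omega
  rw [hk, hk_one]
  simp

theorem IsTable.supportFunction_pos (hγ : IsTable γ P) (hψ : IsNormalAngle γ ψ) (x : ℝ) :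
    0 < supportFunction γ x := by
  set h := supportFunction γ with hh
  have hper : Function.Periodic h Real.pi := hγ.supportFunction_periodic_pi hψ
  have hnonneg : ∀ y, 0 ≤ h y := fun y => by
    have h₁ := hγ.height_le_supportFunction hψ y 0
    have h₂ := hγ.height_le_supportFunction hψ (y + Real.pi) 0
    rw [← hh, hper, height_add_pi] at h₂
    linarith
  refine (hnonneg x).lt_of_ne' fun h₀ => ?_
  have hzero : ∀ y, h y = 0 → γ (ψ.symm y) = 0 := fun y hy => by
    have hmin : IsLocalMin h y := Eventually.of_forall fun z => hy ▸ hnonneg z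
    rw [hγ.curve_eq_supportCurve hψ, ψ.apply_symm_apply, supportCurve, ← hh, hy,
      hmin.deriv_eq_zero]
    simp
  obtain ⟨n, hn⟩ := exists_eq_add_zsmul_of_injOn_Ico hγ.pos hγ.periodic hγ.simple
    ((hzero (x + Real.pi) ((hper x).trans h₀)).trans (hzero x h₀).symm)
  have hn' : x + Real.pi = x + n * (2 * Real.pi) := by
    conv_lhs => rw [← ψ.apply_symm_apply (x + Real.pi), hn,
      map_add_zsmul_of_map_add (hγ.angle_add_period hψ)]
    simp
  have hn_half : (1 : ℝ) * Real.pi = (n * 2 : ℤ) * Real.pi := by push_cast; linarith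
  have : (1 : ℤ) = n * 2 := by exact_mod_cast mul_right_cancel₀ Real.pi_ne_zero hn_half
  omega

theorem IsTable.isOvalSupport (hγ : IsTable γ P) : IsOvalSupport (supportFunction γ) := by
  obtain ⟨ψ, hψ⟩ := hγ.exists_isNormalAngle
  exact ⟨hγ.contDiff_supportFunction, hγ.supportFunction_pos hψ,
    hγ.supportFunction_periodic_pi hψ, fun x =>
      hγ.inv_curvature_eq hψ x ▸ inv_pos.2 (hγ.curvature_pos _)⟩

end Table

/-! ### The area of a table -/

namespace IsOvalSupport

variable {h : ℝ → ℝ}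

theorem contDiff_deriv (hh : IsOvalSupport h) : ContDiff ℝ 1 (deriv h) :=
  contDiff_one_deriv hh.contDiff

theorem continuous (hh : IsOvalSupport h) : Continuous h := hh.contDiff.continuous

theorem continuous_deriv (hh : IsOvalSupport h) : Continuous (deriv h) :=
  hh.contDiff_deriv.continuous

theorem continuous_deriv_deriv (hh : IsOvalSupport h) : Continuous (deriv (deriv h)) :=
  hh.contDiff_deriv.continuous_deriv le_rfl

theorem hasDerivAt (hh : IsOvalSupport h) (x : ℝ) : HasDerivAt h (deriv h x) x :=
  (hh.contDiff.differentiable two_ne_zero x).hasDerivAt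

theorem hasDerivAt_deriv (hh : IsOvalSupport h) (x : ℝ) :
    HasDerivAt (deriv h) (deriv (deriv h) x) x :=
  (hh.contDiff_deriv.differentiable one_ne_zero x).hasDerivAt

theorem hasDerivAt_supportCurve (hh : IsOvalSupport h) (x : ℝ) :
    HasDerivAt (supportCurve h)
      ((h x + deriv (deriv h) x : ℝ) * (Complex.I * Complex.exp (x * Complex.I))) x := by
  have hexp : HasDerivAt (fun x : ℝ => Complex.exp (x * Complex.I))
      (Complex.exp (x * Complex.I) * Complex.I) x := by
    simpa using ((hasDerivAt_id x).ofReal_comp.mul_const Complex.I).cexp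
  refine (((hh.hasDerivAt x).ofReal_comp.fun_add
    ((hh.hasDerivAt_deriv x).ofReal_comp.mul_const Complex.I)).fun_mul hexp).congr_deriv ?_
  push_cast
  linear_combination ((deriv h x : ℝ) : ℂ) * Complex.exp (x * Complex.I) * Complex.I_sq

end IsOvalSupport

theorem height_supportCurve (h : ℝ → ℝ) (x : ℝ) : height x (supportCurve h x) = h x := by
  simp only [height_apply, supportCurve, Complex.exp_mul_I, ← Complex.ofReal_cos,
    ← Complex.ofReal_sin, Complex.mul_re, Complex.mul_im, Complex.add_re, Complex.add_im,
    Complex.ofReal_re, Complex.ofReal_im, Complex.I_re, Complex.I_im]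
  linear_combination h x * Real.sin_sq_add_cos_sq x

theorem conj_supportCurve_mul_im (h : ℝ → ℝ) (x ρ : ℝ) :
    ((starRingEnd ℂ) (supportCurve h x) * (ρ * (Complex.I * Complex.exp (x * Complex.I)))).im =
      h x * ρ := by
  have hexp : (starRingEnd ℂ) (Complex.exp (x * Complex.I)) * Complex.exp (x * Complex.I) = 1 := by
    rw [Complex.conj_mul', Complex.norm_exp_ofReal_mul_I, Complex.ofReal_one, one_pow]
  have hconj : (starRingEnd ℂ) (h x + deriv h x * Complex.I) = h x - deriv h x * Complex.I := by
    simp [sub_eq_add_neg]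
  have hprod : (starRingEnd ℂ) (supportCurve h x) *
      (ρ * (Complex.I * Complex.exp (x * Complex.I))) =
        (deriv h x * ρ : ℝ) + (h x * ρ : ℝ) * Complex.I := by
    rw [supportCurve, map_mul, hconj]
    push_cast
    linear_combination (h x - (deriv h x : ℝ) * Complex.I) * ρ * Complex.I * hexp -
      ((deriv h x : ℝ) : ℂ) * ρ * Complex.I_sq
  rw [hprod, Complex.add_im, Complex.ofReal_im, zero_add, Complex.im_ofReal_mul, Complex.I_im,
    mul_one]

/-- The radial parametrization of the domain swept by the segments from the origin to the points of
the curve `c`. -/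
def radialMap (c : ℝ → ℂ) (p : ℝ × ℝ) : ℂ := p.1 • c p.2

theorem hasFDerivAt_radialMap {c : ℝ → ℂ} {p : ℝ × ℝ} {c' : ℂ} (hc : HasDerivAt c c' p.2) :
    HasFDerivAt (Complex.equivRealProdCLM ∘ radialMap c)
      (Matrix.toLin (.finTwoProd ℝ) (.finTwoProd ℝ)
        !![(c p.2).re, p.1 * c'.re; (c p.2).im, p.1 * c'.im]).toContinuousLinearMap p := by
  rw [Matrix.toLin_finTwoProd_toContinuousLinearMap]
  have h := (Complex.equivRealProdCLM : ℂ →L[ℝ] ℝ × ℝ).hasFDerivAt.comp p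
    ((hasFDerivAt_fst (𝕜 := ℝ) (p := p)).smul (hc.hasFDerivAt.comp p hasFDerivAt_snd))
  refine h.congr_fderiv ?_
  ext <;> simp

theorem volume_real_radialMap_image {c c' : ℝ → ℂ} (hc : ∀ x, HasDerivAt c (c' x) x)
    (hpos : ∀ x, 0 ≤ ((starRingEnd ℂ) (c x) * c' x).im) {a b : ℝ} (hab : a ≤ b)
    (hinj : InjOn (radialMap c) (Ioo 0 1 ×ˢ Ioo a b)) :
    volume.real (radialMap c '' (Ioo 0 1 ×ˢ Ioo a b)) =
      1 / 2 * ∫ x in a..b, ((starRingEnd ℂ) (c x) * c' x).im := by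
  set D : Set (ℝ × ℝ) := Ioo 0 1 ×ˢ Ioo a b
  have hD : MeasurableSet D := measurableSet_Ioo.prod measurableSet_Ioo
  have himage : radialMap c '' D =
      Complex.measurableEquivRealProd ⁻¹' ((Complex.equivRealProdCLM ∘ radialMap c) '' D) := by
    rw [image_comp]
    exact (Complex.measurableEquivRealProd.preimage_image _).symm
  have harea := integral_image_eq_integral_abs_det_fderiv_smul volume hD
    (fun p _ => (hasFDerivAt_radialMap (hc p.2)).hasFDerivWithinAt)
    (Complex.equivRealProdCLM.injective.comp_injOn hinj) (fun _ => (1 : ℝ))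
  rw [setIntegral_const, smul_eq_mul, mul_one] at harea
  calc volume.real (radialMap c '' D)
      = ∫ p in D, p.1 * ((starRingEnd ℂ) (c p.2) * c' p.2).im := by
        rw [himage, Measure.real,
          Complex.volume_preserving_equiv_real_prod.measure_preimage_equiv, ← Measure.real, harea]
        refine setIntegral_congr_fun hD fun p hp => ?_
        simp only [LinearMap.det_toContinuousLinearMap, LinearMap.det_toLin,
          Matrix.det_fin_two_of, smul_eq_mul, mul_one]
        rw [← abs_of_nonneg (mul_nonneg hp.1.1.le (hpos _))]
        simp only [Complex.mul_im, Complex.conj_re, Complex.conj_im]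
        ring_nf
    _ = (∫ r in Ioo (0 : ℝ) 1, r) * ∫ x in Ioo a b, ((starRingEnd ℂ) (c x) * c' x).im := by
        rw [Measure.volume_eq_prod, setIntegral_prod_mul (fun r : ℝ => r)
          (fun x => ((starRingEnd ℂ) (c x) * c' x).im)]
    _ = 1 / 2 * ∫ x in a..b, ((starRingEnd ℂ) (c x) * c' x).im := by
        rw [← integral_Ioc_eq_integral_Ioo, ← integral_Ioc_eq_integral_Ioo,
          ← intervalIntegral.integral_of_le zero_le_one, ← intervalIntegral.integral_of_le hab,
          integral_id]
        norm_num

theorem injOn_radialMap {c : ℝ → ℂ} {h : ℝ → ℝ} (hpos : ∀ x, 0 < h x)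
    (hle : ∀ x y, height x (c y) ≤ h x) (heq : ∀ x, height x (c x) = h x) {s : Set ℝ}
    (hinj : InjOn c s) : InjOn (radialMap c) (Ioi 0 ×ˢ s) := by
  have radius_le : ∀ p q : ℝ × ℝ, 0 < p.1 → radialMap c p = radialMap c q → q.1 ≤ p.1 := by
    intro p q hp hpq
    have h₁ : p.1 * height q.2 (c p.2) = q.1 * h q.2 := by
      simpa only [radialMap, map_smul, smul_eq_mul, heq] using congrArg (height q.2) hpq
    exact le_of_mul_le_mul_right
      (h₁ ▸ mul_le_mul_of_nonneg_left (hle q.2 p.2) hp.le) (hpos q.2)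
  intro p hp q hq hpq
  have hr : p.1 = q.1 := le_antisymm (radius_le q p hq.1 hpq.symm) (radius_le p q hp.1 hpq)
  refine Prod.ext hr (hinj hp.2 hq.2 (smul_right_injective ℂ (mem_Ioi.1 hp.1).ne' ?_))
  simpa only [radialMap, ← hr] using hpq

section Table

variable {γ : ℝ → ℂ} {P : ℝ}

theorem IsTable.injOn_supportCurve (hγ : IsTable γ P) :
    InjOn (supportCurve (supportFunction γ)) (Ico 0 (2 * Real.pi)) := by
  obtain ⟨ψ, hψ⟩ := hγ.exists_isNormalAngle
  intro x hx y hy hxy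
  rw [← ψ.apply_symm_apply x, ← ψ.apply_symm_apply y, ← hγ.curve_eq_supportCurve hψ,
    ← hγ.curve_eq_supportCurve hψ] at hxy
  obtain ⟨n, hn⟩ := exists_eq_add_zsmul_of_injOn_Ico hγ.pos hγ.periodic hγ.simple hxy
  have hxn : x = y + n • (2 * Real.pi) := by
    rw [← ψ.apply_symm_apply x, hn, map_add_zsmul_of_map_add (hγ.angle_add_period hψ),
      ψ.apply_symm_apply]
  obtain rfl : n = 0 := (existsUnique_add_zsmul_mem_Ico Real.two_pi_pos y 0).unique
    (by simpa only [zero_add, ← hxn] using hx) (by simpa using hy)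
  simpa using hxn

theorem IsTable.radialMap_image_subset (hγ : IsTable γ P) :
    radialMap (supportCurve (supportFunction γ)) '' (Ioo 0 1 ×ˢ Ioo 0 (2 * Real.pi)) ⊆
      convexHull ℝ (range γ) := by
  obtain ⟨ψ, hψ⟩ := hγ.exists_isNormalAngle
  have hconv := convex_convexHull ℝ (range γ)
  have hzero : (0 : ℂ) ∈ convexHull ℝ (range γ) := by
    simpa using hconv.midpoint_mem (subset_convexHull ℝ _ (mem_range_self 0))
      (subset_convexHull ℝ _ (hγ.symmetric 0))
  rintro - ⟨p, hp, rfl⟩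
  rw [radialMap, ← ψ.apply_symm_apply p.2, ← hγ.curve_eq_supportCurve hψ]
  exact hconv.smul_mem_of_zero_mem hzero (subset_convexHull ℝ _ (mem_range_self _))
    (Ioo_subset_Icc_self hp.1)

theorem IsTable.half_integral_le_area (hγ : IsTable γ P) :
    1 / 2 * ∫ x in 0..2 * Real.pi, supportFunction γ x *
      (supportFunction γ x + deriv (deriv (supportFunction γ)) x) ≤ area γ := by
  obtain ⟨ψ, hψ⟩ := hγ.exists_isNormalAngle
  have hh := hγ.isOvalSupport
  set h := supportFunction γ
  have hinj : InjOn (radialMap (supportCurve h)) (Ioo 0 1 ×ˢ Ioo 0 (2 * Real.pi)) :=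
    (injOn_radialMap hh.pos (fun x y => by
      simpa only [hγ.curve_eq_supportCurve hψ, ψ.apply_symm_apply] using
        hγ.height_le_supportFunction hψ x (ψ.symm y)) (height_supportCurve h)
      hγ.injOn_supportCurve).mono (prod_mono Ioo_subset_Ioi_self Ioo_subset_Ico_self)
  have hvol := volume_real_radialMap_image hh.hasDerivAt_supportCurve (fun x => by
    rw [conj_supportCurve_mul_im]; exact (mul_pos (hh.pos x) (hh.radius_pos x)).le)
    Real.two_pi_pos.le hinj
  simp only [conj_supportCurve_mul_im] at hvol
  rw [← hvol]
  have hbounded : Bornology.IsBounded (convexHull ℝ (range γ)) := isBounded_convexHull.2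
    (hγ.periodic.compact_of_continuous hγ.pos.ne' hγ.contDiff.continuous).isBounded
  exact measureReal_mono hγ.radialMap_image_subset hbounded.measure_lt_top.ne

end Table

/-! ### An energy inequality for quarter-turn antisymmetric angles -/

section Wirtinger

variable {u : ℝ → ℝ}

theorem sq_mul_integral_sq_le_integral_deriv_sq (hu : ContDiff ℝ 1 u) {a b ω : ℝ} (hab : a ≤ b)
    (hω : ω * (b - a) < Real.pi) (hω₀ : 0 ≤ ω) (ha : u a = 0) (hb : u b = 0) :
    ω ^ 2 * ∫ x in a..b, u x ^ 2 ≤ ∫ x in a..b, deriv u x ^ 2 := by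
  have hcu := hu.continuous
  set t : ℝ → ℝ := fun x => Real.tan (ω * (x - (a + b) / 2))
  have hcos : ∀ x ∈ uIcc a b, 0 < Real.cos (ω * (x - (a + b) / 2)) := by
    intro x hx
    rw [uIcc_of_le hab] at hx
    refine Real.cos_pos_of_mem_Ioo ⟨?_, ?_⟩ <;>
      nlinarith [mul_le_mul_of_nonneg_left hx.1 hω₀, mul_le_mul_of_nonneg_left hx.2 hω₀]
  have ht : ∀ x ∈ uIcc a b, HasDerivAt t (ω * (1 + t x ^ 2)) x := by
    intro x hx
    have h := (Real.hasDerivAt_tan (hcos x hx).ne').comp x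
      (((hasDerivAt_id x).sub_const ((a + b) / 2)).const_mul ω)
    refine h.congr_deriv ?_
    rw [mul_one, ← Real.inv_one_add_tan_sq (hcos x hx).ne', one_div, inv_inv, mul_comm]
  -- Completing the square: `(ω t u²)' = (u' + ω t u)² - (u'² - ω² u²)`, as `t' = ω (1 + t²)`.
  have hder : ∀ x ∈ uIcc a b, HasDerivAt (fun x => ω * t x * u x ^ 2)
      ((deriv u x + ω * t x * u x) ^ 2 - (deriv u x ^ 2 - ω ^ 2 * u x ^ 2)) x := by
    intro x hx
    refine (((ht x hx).const_mul ω).fun_mul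
      ((hu.differentiable one_ne_zero x).hasDerivAt.fun_pow 2)).congr_deriv ?_
    push_cast
    ring
  have hct : ContinuousOn t (uIcc a b) := fun x hx => (ht x hx).continuousAt.continuousWithinAt
  have hi₁ : IntervalIntegrable (fun x => (deriv u x + ω * t x * u x) ^ 2) volume a b :=
    ContinuousOn.intervalIntegrable (by fun_prop)
  have hi₂ : IntervalIntegrable (fun x => deriv u x ^ 2) volume a b :=
    Continuous.intervalIntegrable (by fun_prop) _ _
  have hi₃ : IntervalIntegrable (fun x => ω ^ 2 * u x ^ 2) volume a b :=
    Continuous.intervalIntegrable (by fun_prop) _ _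
  have hint := intervalIntegral.integral_eq_sub_of_hasDerivAt hder (hi₁.sub (hi₂.sub hi₃))
  rw [intervalIntegral.integral_sub hi₁ (hi₂.sub hi₃), intervalIntegral.integral_sub hi₂ hi₃,
    intervalIntegral.integral_const_mul, ha, hb] at hint
  have hnonneg := intervalIntegral.integral_nonneg_of_forall (μ := volume) hab
    (fun x => sq_nonneg (deriv u x + ω * t x * u x))
  linarith

theorem wirtinger_inequality (hu : ContDiff ℝ 1 u) {a b : ℝ} (hab : a < b) (ha : u a = 0)
    (hb : u b = 0) :
    (Real.pi / (b - a)) ^ 2 * ∫ x in a..b, u x ^ 2 ≤ ∫ x in a..b, deriv u x ^ 2 := by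
  have hlen := sub_pos.2 hab
  have hcont : Continuous fun ω => ω ^ 2 * ∫ x in a..b, u x ^ 2 := by fun_prop
  refine le_of_tendsto (hcont.continuousWithinAt (s := Iio (Real.pi / (b - a)))) ?_
  filter_upwards [Ioo_mem_nhdsLT (div_pos Real.pi_pos hlen)] with ω hω
  exact sq_mul_integral_sq_le_integral_deriv_sq hu hab.le ((lt_div_iff₀ hlen).1 hω.2) hω.1.le ha hb

theorem wirtinger_inequality_of_antiperiodic (hu : ContDiff ℝ 1 u) {T : ℝ} (hT : 0 < T)
    (hanti : Function.Antiperiodic u T) :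
    (Real.pi / T) ^ 2 * ∫ x in 0..T, u x ^ 2 ≤ ∫ x in 0..T, deriv u x ^ 2 := by
  obtain ⟨a, ha⟩ : ∃ a, u a = 0 := by
    have hzero : (0 : ℝ) ∈ uIcc (u 0) (u T) := by
      rw [hanti.eq, mem_uIcc]
      rcases le_total (u 0) 0 with h | h
      · exact .inl ⟨h, neg_nonneg.2 h⟩
      · exact .inr ⟨neg_nonpos.2 h, h⟩
    obtain ⟨a, -, ha⟩ := intermediate_value_uIcc hu.continuous.continuousOn hzero
    exact ⟨a, ha⟩
  have hu_sq : Function.Periodic (fun x => u x ^ 2) T := fun x => by simp only [hanti x, neg_sq]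
  have hu'_sq : Function.Periodic (fun x => deriv u x ^ 2) T := fun x => by
    simp only [deriv_antiperiodic hanti x, neg_sq]
  have h := wirtinger_inequality hu (lt_add_of_pos_right a hT) ha (by rw [hanti, ha, neg_zero])
  rwa [add_sub_cancel_left, hu_sq.intervalIntegral_add_eq a 0,
    hu'_sq.intervalIntegral_add_eq a 0, zero_add] at h

end Wirtinger

/-- The integral of `sin² δ` over the interval from `θ` to `π - θ`. -/
def wedge (θ : ℝ) : ℝ := Real.pi / 2 - θ + Real.sin θ * Real.cos θ

theorem hasDerivAt_wedge (θ : ℝ) : HasDerivAt wedge (-2 * Real.sin θ ^ 2) θ := by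
  refine (((hasDerivAt_id θ).const_sub (Real.pi / 2)).add
    ((Real.hasDerivAt_sin θ).mul (Real.hasDerivAt_cos θ))).congr_deriv ?_
  linear_combination Real.sin_sq_add_cos_sq θ

theorem continuous_wedge : Continuous wedge :=
  continuous_iff_continuousAt.2 fun x => (hasDerivAt_wedge x).continuousAt

/-- The integrand to which `h'' (h + h'') wedge d` reduces after an integration by parts when
`h = sin d`, `d' = u` and `d'' = v`. -/
def energy (θ u v : ℝ) : ℝ :=
  Real.cos θ ^ 2 * wedge θ * v ^ 2
  + (Real.sin θ ^ 2 * wedge θ + 2 / 3 * ((Real.cos θ ^ 2 - Real.sin θ ^ 2) * wedge θ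
      - 2 * Real.sin θ ^ 3 * Real.cos θ)) * u ^ 4
  - (Real.cos θ ^ 2 * wedge θ - 2 * Real.sin θ ^ 3 * Real.cos θ) * u ^ 2

theorem energy_add (b u v : ℝ) :
    energy (Real.pi / 4 - b) u v + energy (Real.pi / 4 + b) (-u) (-v) =
      (Real.pi / 4 + b * Real.sin (2 * b) + Real.cos (2 * b) / 2) * v ^ 2
      + (Real.pi / 4 + b * Real.sin (2 * b) / 3 - Real.cos (2 * b) / 6) * u ^ 4
      - (Real.pi / 4 + b * Real.sin (2 * b) - Real.cos (2 * b) / 2) * u ^ 2 := by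
  have hcompl : Real.pi / 4 + b = Real.pi / 2 - (Real.pi / 4 - b) := by ring
  have hb : 2 * b = Real.pi / 2 - 2 * (Real.pi / 4 - b) := by ring
  have hc : Real.cos (Real.pi / 4 - b) ^ 2 = 1 - Real.sin (Real.pi / 4 - b) ^ 2 := Real.cos_sq' _
  have hc₃ : Real.cos (Real.pi / 4 - b) ^ 3 =
      (1 - Real.sin (Real.pi / 4 - b) ^ 2) * Real.cos (Real.pi / 4 - b) := by rw [← hc]; ring
  simp only [energy, wedge]
  rw [hcompl, hb, Real.sin_pi_div_two_sub, Real.cos_pi_div_two_sub, Real.sin_pi_div_two_sub,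
    Real.cos_pi_div_two_sub, Real.sin_two_mul, Real.cos_two_mul', hc₃, hc]
  ring

theorem sq_le_mul_sin_two_mul {b : ℝ} (hb : |b| ≤ Real.pi / 4) : b ^ 2 ≤ b * Real.sin (2 * b) := by
  wlog hb₀ : 0 ≤ b generalizing b
  · simpa using this (b := -b) (by rwa [abs_neg]) (by linarith)
  have hjordan := Real.mul_le_sin (x := 2 * b) (by linarith) (by linarith [le_abs_self b])
  have hslope : b ≤ 2 / Real.pi * (2 * b) := by
    rw [div_mul_eq_mul_div, le_div_iff₀ Real.pi_pos]
    nlinarith [Real.pi_le_four]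
  rw [sq]
  gcongr
  exact hslope.trans hjordan

theorem le_energy_add {θ : ℝ} (hθ : θ ∈ Icc 0 (Real.pi / 2)) (u v : ℝ) :
    (Real.pi / 4 + 1 / 2) * v ^ 2 - Real.pi / 2 * u ^ 2 ≤
      energy θ u v + energy (Real.pi / 2 - θ) (-u) (-v) := by
  obtain ⟨b, rfl⟩ : ∃ b, θ = Real.pi / 4 - b := ⟨Real.pi / 4 - θ, by ring⟩
  have hb : |b| ≤ Real.pi / 4 := abs_le.2 ⟨by linarith [hθ.2], by linarith [hθ.1]⟩
  have hlow : 1 / 2 - Real.cos (2 * b) / 2 ≤ b * Real.sin (2 * b) := by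
    rw [← Real.sin_sq_eq_half_sub]
    exact Real.sin_sq_le_sq.trans (sq_le_mul_sin_two_mul hb)
  have hup : b * Real.sin (2 * b) ≤ Real.pi / 4 :=
    calc b * Real.sin (2 * b) ≤ |b * Real.sin (2 * b)| := le_abs_self _
      _ = |b| * |Real.sin (2 * b)| := abs_mul _ _
      _ ≤ |b| * 1 := by gcongr; exact Real.abs_sin_le_one _
      _ ≤ Real.pi / 4 := by rwa [mul_one]
  have hcos₀ : 0 ≤ Real.cos (2 * b) :=
    Real.cos_nonneg_of_mem_Icc ⟨by linarith [abs_le.1 hb], by linarith [abs_le.1 hb]⟩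
  have hcos₁ := Real.cos_le_one (2 * b)
  have hquartic : 0 ≤ Real.pi / 4 + b * Real.sin (2 * b) / 3 - Real.cos (2 * b) / 6 := by
    linarith [Real.pi_gt_three]
  rw [show Real.pi / 2 - (Real.pi / 4 - b) = Real.pi / 4 + b by ring, energy_add]
  linarith [mul_nonneg (sub_nonneg.2 hlow) (sq_nonneg v),
    mul_nonneg (sub_nonneg.2 hup) (sq_nonneg u), mul_nonneg hcos₀ (sq_nonneg u),
    mul_nonneg hquartic (by positivity : 0 ≤ u ^ 4)]

/-- A `C²` angle function with values in `(0, π/2)` which a quarter turn reflects in `π/4`. -/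
structure IsQuarterAngle (d : ℝ → ℝ) : Prop where
  contDiff : ContDiff ℝ 2 d
  mem_Ioo : ∀ x, d x ∈ Ioo 0 (Real.pi / 2)
  add_pi_div_two : ∀ x, d (x + Real.pi / 2) = Real.pi / 2 - d x

theorem integral_two_pi_eq {f : ℝ → ℝ} (hf : Continuous f) (hper : Function.Periodic f Real.pi) :
    ∫ x in 0..2 * Real.pi, f x =
      2 * ∫ x in 0..Real.pi / 2, (f x + f (x + Real.pi / 2)) := by
  have hint : ∀ a b, IntervalIntegrable f volume a b := hf.intervalIntegrable
  have hshift : Continuous fun x => f (x + Real.pi / 2) := by fun_prop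
  rw [intervalIntegral.integral_add (hint _ _) (hshift.intervalIntegrable _ _),
    intervalIntegral.integral_comp_add_right, zero_add, add_halves,
    intervalIntegral.integral_add_adjacent_intervals (hint _ _) (hint _ _)]
  have h := hper.intervalIntegral_add_zsmul_eq 2 0 hint
  simpa using h

namespace IsQuarterAngle

variable {d : ℝ → ℝ}

theorem continuous (hd : IsQuarterAngle d) : Continuous d := hd.contDiff.continuous

theorem contDiff_deriv (hd : IsQuarterAngle d) : ContDiff ℝ 1 (deriv d) :=
  contDiff_one_deriv hd.contDiff

theorem continuous_deriv (hd : IsQuarterAngle d) : Continuous (deriv d) :=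
  hd.contDiff_deriv.continuous

theorem continuous_deriv_deriv (hd : IsQuarterAngle d) : Continuous (deriv (deriv d)) :=
  hd.contDiff_deriv.continuous_deriv le_rfl

theorem hasDerivAt (hd : IsQuarterAngle d) (x : ℝ) : HasDerivAt d (deriv d x) x :=
  (hd.contDiff.differentiable two_ne_zero x).hasDerivAt

theorem hasDerivAt_deriv (hd : IsQuarterAngle d) (x : ℝ) :
    HasDerivAt (deriv d) (deriv (deriv d) x) x :=
  (hd.contDiff_deriv.differentiable one_ne_zero x).hasDerivAt

theorem antiperiodic_deriv (hd : IsQuarterAngle d) :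
    Function.Antiperiodic (deriv d) (Real.pi / 2) := fun x => by
  rw [← deriv_comp_add_const, funext hd.add_pi_div_two, deriv_const_sub]

theorem periodic (hd : IsQuarterAngle d) : Function.Periodic d Real.pi := fun x => by
  rw [← add_halves Real.pi, ← add_assoc, hd.add_pi_div_two, hd.add_pi_div_two, sub_sub_cancel]

theorem continuous_energy (hd : IsQuarterAngle d) :
    Continuous fun x => energy (d x) (deriv d x) (deriv (deriv d) x) := by
  have h₀ := hd.continuous
  have h₁ := hd.continuous_deriv
  have h₂ := hd.continuous_deriv_deriv
  have hw := continuous_wedge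
  unfold energy
  fun_prop

theorem le_integral_energy (hd : IsQuarterAngle d) :
    (Real.pi / 4 + 1) * ∫ x in 0..2 * Real.pi, deriv d x ^ 2 ≤
      ∫ x in 0..2 * Real.pi, energy (d x) (deriv d x) (deriv (deriv d) x) := by
  have h₁ := hd.continuous_deriv
  have h₂ := hd.continuous_deriv_deriv
  have hanti := hd.antiperiodic_deriv
  have hanti' := deriv_antiperiodic hanti
  have hperE : Function.Periodic (fun x => energy (d x) (deriv d x) (deriv (deriv d) x)) Real.pi :=
    fun x => by
      simp only [hd.periodic x, deriv_periodic hd.periodic x,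
        deriv_periodic (deriv_periodic hd.periodic) x]
  have hper' : Function.Periodic (fun x => deriv d x ^ 2) Real.pi := fun x => by
    simp only [deriv_periodic hd.periodic x]
  have hbound : ∫ x in 0..Real.pi / 2,
      ((Real.pi / 4 + 1 / 2) * deriv (deriv d) x ^ 2 - Real.pi / 2 * deriv d x ^ 2) ≤
      ∫ x in 0..Real.pi / 2, (energy (d x) (deriv d x) (deriv (deriv d) x) +
        energy (d (x + Real.pi / 2)) (deriv d (x + Real.pi / 2))
          (deriv (deriv d) (x + Real.pi / 2))) := by
    refine intervalIntegral.integral_mono Real.pi_div_two_pos.le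
      (Continuous.intervalIntegrable (by fun_prop) _ _) (Continuous.intervalIntegrable
        (hd.continuous_energy.add (hd.continuous_energy.comp (continuous_add_const _))) _ _)
      fun x => ?_
    simp only [hd.add_pi_div_two x, hanti x, hanti' x]
    exact le_energy_add (Ioo_subset_Icc_self (hd.mem_Ioo x)) _ _
  have hwirtinger :=
    wirtinger_inequality_of_antiperiodic hd.contDiff_deriv Real.pi_div_two_pos hanti
  rw [div_div_cancel₀ Real.pi_ne_zero] at hwirtinger
  rw [intervalIntegral.integral_sub (Continuous.intervalIntegrable (by fun_prop) _ _)
      (Continuous.intervalIntegrable (by fun_prop) _ _),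
    intervalIntegral.integral_const_mul, intervalIntegral.integral_const_mul] at hbound
  have hquarter : ∫ x in 0..2 * Real.pi, deriv d x ^ 2 =
      4 * ∫ x in 0..Real.pi / 2, deriv d x ^ 2 := by
    rw [integral_two_pi_eq (by fun_prop) hper']
    simp only [hanti _, neg_sq, ← two_mul, intervalIntegral.integral_const_mul]
    ring
  rw [hquarter, integral_two_pi_eq hd.continuous_energy hperE]
  linarith [mul_le_mul_of_nonneg_left hwirtinger (by positivity : 0 ≤ Real.pi / 4 + 1 / 2)]

theorem integral_cos_mul_deriv_sq (hd : IsQuarterAngle d) :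
    ∫ x in 0..2 * Real.pi, (Real.cos (d x) * deriv d x) ^ 2 =
      1 / 2 * ∫ x in 0..2 * Real.pi, deriv d x ^ 2 := by
  have h₀ := hd.continuous
  have h₁ := hd.continuous_deriv
  have hanti := hd.antiperiodic_deriv
  have hper' := deriv_periodic hd.periodic
  rw [integral_two_pi_eq (by fun_prop) fun x => by simp only [hd.periodic x, hper' x],
    integral_two_pi_eq (by fun_prop) fun x => by simp only [hper' x]]
  simp only [hd.add_pi_div_two, hanti _, Real.cos_pi_div_two_sub, neg_sq, ← two_mul,
    intervalIntegral.integral_const_mul]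
  have hpyth : ∀ x, (Real.cos (d x) * deriv d x) ^ 2 + (Real.sin (d x) * -deriv d x) ^ 2 =
      deriv d x ^ 2 := fun x => by
    linear_combination deriv d x ^ 2 * Real.sin_sq_add_cos_sq (d x)
  simp only [hpyth]
  ring

theorem integral_eq_integral_energy (hd : IsQuarterAngle d) :
    ∫ x in 0..2 * Real.pi,
      (Real.cos (d x) * deriv (deriv d) x - Real.sin (d x) * deriv d x ^ 2) *
      (Real.sin (d x) + (Real.cos (d x) * deriv (deriv d) x - Real.sin (d x) * deriv d x ^ 2)) *
      wedge (d x) =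
      ∫ x in 0..2 * Real.pi, energy (d x) (deriv d x) (deriv (deriv d) x) := by
  have h₀ := hd.continuous
  have h₁ := hd.continuous_deriv
  have h₂ := hd.continuous_deriv_deriv
  have hw := continuous_wedge
  have hE := hd.continuous_energy
  have hder : ∀ x, HasDerivAt (fun x => Real.sin (d x) * Real.cos (d x) * wedge (d x)
      * (deriv d x - 2 / 3 * deriv d x ^ 3))
      ((Real.cos (d x) * deriv (deriv d) x - Real.sin (d x) * deriv d x ^ 2) *
        (Real.sin (d x) + (Real.cos (d x) * deriv (deriv d) x - Real.sin (d x) * deriv d x ^ 2)) *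
        wedge (d x) - energy (d x) (deriv d x) (deriv (deriv d) x)) x := by
    intro x
    have hsc := (hd.hasDerivAt x).sin.fun_mul (hd.hasDerivAt x).cos
    have hwedge := (hasDerivAt_wedge (d x)).comp x (hd.hasDerivAt x)
    have hcubic := (hd.hasDerivAt_deriv x).fun_sub
      (((hd.hasDerivAt_deriv x).fun_pow 3).const_mul (2 / 3 : ℝ))
    refine ((hsc.fun_mul hwedge).fun_mul hcubic).congr_deriv ?_
    simp only [energy, Function.comp_apply]
    push_cast
    ring
  have hint := intervalIntegral.integral_eq_sub_of_hasDerivAt (a := 0) (b := 2 * Real.pi)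
    (fun x _ => hder x) (Continuous.intervalIntegrable (by fun_prop) _ _)
  have hper : Function.Periodic d (2 * Real.pi) := by simpa using hd.periodic.nat_mul 2
  rw [intervalIntegral.integral_sub (Continuous.intervalIntegrable (by fun_prop) _ _)
    (hE.intervalIntegrable _ _), hper.eq, (deriv_periodic hper).eq, sub_self] at hint
  exact sub_eq_zero.1 hint

end IsQuarterAngle

/-! ### Ovals with a circular orthoptic curve -/

theorem sq_integral_le_mul_integral_sq {f : ℝ → ℝ} (hf : Continuous f) {a b : ℝ} (hab : a < b) :
    (∫ x in a..b, f x) ^ 2 ≤ (b - a) * ∫ x in a..b, f x ^ 2 := by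
  set m := ∫ x in a..b, f x with hm
  have hnonneg := intervalIntegral.integral_nonneg_of_forall (μ := volume) hab.le
    fun x => sq_nonneg ((b - a) * f x - m)
  have hexpand : ∀ x, ((b - a) * f x - m) ^ 2 =
      (b - a) ^ 2 * f x ^ 2 - 2 * (b - a) * m * f x + m ^ 2 := fun x => by ring
  simp only [hexpand] at hnonneg
  rw [intervalIntegral.integral_add (Continuous.intervalIntegrable (by fun_prop) _ _)
      (Continuous.intervalIntegrable (by fun_prop) _ _),
    intervalIntegral.integral_sub (Continuous.intervalIntegrable (by fun_prop) _ _)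
      (Continuous.intervalIntegrable (by fun_prop) _ _),
    intervalIntegral.integral_const_mul, intervalIntegral.integral_const_mul, ← hm,
    intervalIntegral.integral_const, smul_eq_mul] at hnonneg
  nlinarith [sub_pos.2 hab]

theorem integral_mul_deriv_deriv {h : ℝ → ℝ} (hh : ContDiff ℝ 2 h) {T : ℝ}
    (hper : Function.Periodic h T) :
    ∫ x in 0..T, h x * deriv (deriv h) x = -∫ x in 0..T, deriv h x ^ 2 := by
  have hh' := contDiff_one_deriv hh
  have hcont := hh'.continuous
  rw [intervalIntegral.integral_mul_deriv_eq_deriv_mul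
    (fun x _ => (hh.differentiable two_ne_zero x).hasDerivAt)
    (fun x _ => (hh'.differentiable one_ne_zero x).hasDerivAt)
    (hcont.intervalIntegrable _ _) ((hh'.continuous_deriv le_rfl).intervalIntegrable _ _),
    hper.eq, (deriv_periodic hper).eq, sub_self, zero_sub]
  simp only [sq]

namespace IsQuarterAngle

variable {d h : ℝ → ℝ} {R : ℝ}

theorem deriv_mul_sin (hd : IsQuarterAngle d) (hh : ∀ x, h x = R * Real.sin (d x)) (x : ℝ) :
    deriv h x = R * (Real.cos (d x) * deriv d x) := by
  rw [funext hh]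
  exact ((hd.hasDerivAt x).sin.const_mul R).deriv

theorem deriv_deriv_mul_sin (hd : IsQuarterAngle d) (hh : ∀ x, h x = R * Real.sin (d x)) (x : ℝ) :
    deriv (deriv h) x =
      R * (Real.cos (d x) * deriv (deriv d) x - Real.sin (d x) * deriv d x ^ 2) := by
  rw [funext (hd.deriv_mul_sin hh),
    (((hd.hasDerivAt x).cos.fun_mul (hd.hasDerivAt_deriv x)).const_mul R).deriv]
  ring

theorem mul_isoperimetric_deficit_le (hd : IsQuarterAngle d) (hh : ∀ x, h x = R * Real.sin (d x))
    {c : ℝ} (hc₀ : 0 ≤ c) (hc : c ≤ 1 / 4 + 1 / Real.pi) :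
    c * ((∫ x in 0..2 * Real.pi, h x) ^ 2
      - 2 * Real.pi * ∫ x in 0..2 * Real.pi, h x * (h x + deriv (deriv h) x)) ≤
    ∫ x in 0..2 * Real.pi, deriv (deriv h) x * (h x + deriv (deriv h) x) * wedge (d x) := by
  have hsmooth : ContDiff ℝ 2 h := by
    rw [funext hh]
    exact contDiff_const.mul (Real.contDiff_sin.comp hd.contDiff)
  have hcont := hsmooth.continuous
  have hper : Function.Periodic h (2 * Real.pi) := fun x => by
    rw [hh, hh, two_mul, ← add_assoc, hd.periodic, hd.periodic]
  set U := ∫ x in 0..2 * Real.pi, deriv d x ^ 2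
  have hU : 0 ≤ U := intervalIntegral.integral_nonneg_of_forall Real.two_pi_pos.le
    fun x => sq_nonneg _
  have henergy : ∫ x in 0..2 * Real.pi,
      deriv (deriv h) x * (h x + deriv (deriv h) x) * wedge (d x) =
        R ^ 2 * ∫ x in 0..2 * Real.pi, energy (d x) (deriv d x) (deriv (deriv d) x) := by
    rw [← hd.integral_eq_integral_energy, ← intervalIntegral.integral_const_mul]
    refine intervalIntegral.integral_congr fun x _ => ?_
    simp only [hh x, hd.deriv_deriv_mul_sin hh]
    ring
  have hderiv : ∫ x in 0..2 * Real.pi, deriv h x ^ 2 = R ^ 2 * (1 / 2 * U) := by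
    simp only [hd.deriv_mul_sin hh, mul_pow R, intervalIntegral.integral_const_mul,
      hd.integral_cos_mul_deriv_sq, U]
  have hparts : ∫ x in 0..2 * Real.pi, h x * (h x + deriv (deriv h) x) =
      (∫ x in 0..2 * Real.pi, h x ^ 2) - R ^ 2 * (1 / 2 * U) := by
    simp only [mul_add, ← sq]
    rw [intervalIntegral.integral_add (Continuous.intervalIntegrable (by fun_prop) _ _)
      (Continuous.intervalIntegrable (by fun_prop) _ _), integral_mul_deriv_deriv hsmooth hper,
      hderiv, sub_eq_add_neg]
  have hjensen := sq_integral_le_mul_integral_sq hcont Real.two_pi_pos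
  rw [sub_zero] at hjensen
  rw [henergy, hparts]
  have hcpi : c * Real.pi ≤ Real.pi / 4 + 1 :=
    (mul_le_mul_of_nonneg_right hc Real.pi_pos.le).trans_eq (by field_simp)
  calc c * ((∫ x in 0..2 * Real.pi, h x) ^ 2 -
        2 * Real.pi * ((∫ x in 0..2 * Real.pi, h x ^ 2) - R ^ 2 * (1 / 2 * U)))
      ≤ c * Real.pi * (R ^ 2 * U) := by linarith [mul_le_mul_of_nonneg_left hjensen hc₀]
    _ ≤ (Real.pi / 4 + 1) * (R ^ 2 * U) := by gcongr
    _ ≤ R ^ 2 * ∫ x in 0..2 * Real.pi, energy (d x) (deriv d x) (deriv (deriv d) x) := by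
        linarith [mul_le_mul_of_nonneg_left hd.le_integral_energy (sq_nonneg R)]

end IsQuarterAngle

section Orthoptic

variable {h : ℝ → ℝ} {R : ℝ}

theorem div_mem_Ioo (hpos : ∀ x, 0 < h x) (hR : 0 < R)
    (horth : ∀ x, h x ^ 2 + h (x + Real.pi / 2) ^ 2 = R ^ 2) (x : ℝ) : h x / R ∈ Ioo 0 1 := by
  refine ⟨div_pos (hpos x) hR, (div_lt_one hR).2 (lt_of_pow_lt_pow_left₀ 2 hR.le ?_)⟩
  linarith [horth x, pow_pos (hpos (x + Real.pi / 2)) 2]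

theorem isQuarterAngle_arcsin (hh : ContDiff ℝ 2 h) (hpos : ∀ x, 0 < h x) (hR : 0 < R)
    (horth : ∀ x, h x ^ 2 + h (x + Real.pi / 2) ^ 2 = R ^ 2) :
    IsQuarterAngle fun x => Real.arcsin (h x / R) := by
  have hmem := div_mem_Ioo hpos hR horth
  refine ⟨contDiff_iff_contDiffAt.2 fun x => ?_, fun x => ⟨Real.arcsin_pos.2 (hmem x).1,
    Real.arcsin_lt_pi_div_two.2 (hmem x).2⟩, fun x => Real.arcsin_eq_of_sin_eq ?_ ?_⟩
  · have hne : h x / R ≠ -1 := by linarith [(hmem x).1]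
    exact ContDiffAt.comp (g := Real.arcsin) x (Real.contDiffAt_arcsin hne (hmem x).2.ne)
      (hh.div_const R).contDiffAt
  · rw [Real.sin_pi_div_two_sub, Real.cos_arcsin, Real.sqrt_eq_iff_eq_sq]
    · rw [div_pow, div_pow, eq_div_iff (by positivity), sub_mul, div_mul_cancel₀ _ (by positivity)]
      linarith [horth x]
    · nlinarith [(hmem x).1, (hmem x).2]
    · exact (hmem _).1.le
  · exact ⟨by linarith [Real.arcsin_le_pi_div_two (h x / R), Real.pi_pos],
      by linarith [Real.arcsin_nonneg.2 (hmem x).1.le]⟩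

theorem orthoptic_inequality (hh : ContDiff ℝ 2 h) (hpos : ∀ x, 0 < h x) (hR : 0 < R)
    (horth : ∀ x, h x ^ 2 + h (x + Real.pi / 2) ^ 2 = R ^ 2) {c : ℝ} (hc₀ : 0 ≤ c)
    (hc : c ≤ 1 / 4 + 1 / Real.pi) :
    c * ((∫ x in 0..2 * Real.pi, h x) ^ 2
      - 2 * Real.pi * ∫ x in 0..2 * Real.pi, h x * (h x + deriv (deriv h) x)) ≤
    ∫ x in 0..2 * Real.pi, deriv (deriv h) x * (h x + deriv (deriv h) x)
      * wedge (Real.arcsin (h x / R)) := by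
  refine (isQuarterAngle_arcsin hh hpos hR horth).mul_isoperimetric_deficit_le (R := R)
    (fun x => ?_) hc₀ hc
  have hmem := div_mem_Ioo hpos hR horth x
  rw [Real.sin_arcsin (by linarith [hmem.1]) hmem.2.le, mul_div_cancel₀ _ hR.ne']

end Orthoptic

/-! ### Chords of an oval -/

theorem height_eq_cos_mul_add_sin_mul (x y : ℝ) (z : ℂ) :
    height y z =
      Real.cos (y - x) * height x z + Real.sin (y - x) * height (x + Real.pi / 2) z := by
  simp only [height_apply, Real.cos_sub, Real.sin_sub, Real.cos_add_pi_div_two,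
    Real.sin_add_pi_div_two]
  linear_combination -(Real.cos y * z.re + Real.sin y * z.im) * Real.sin_sq_add_cos_sq x

theorem height_add_pi_div_two_supportCurve (h : ℝ → ℝ) (x : ℝ) :
    height (x + Real.pi / 2) (supportCurve h x) = deriv h x := by
  simp only [height_apply, supportCurve, Complex.exp_mul_I, ← Complex.ofReal_cos,
    ← Complex.ofReal_sin, Complex.mul_re, Complex.mul_im, Complex.add_re, Complex.add_im,
    Complex.ofReal_re, Complex.ofReal_im, Complex.I_re, Complex.I_im, Real.cos_add_pi_div_two,
    Real.sin_add_pi_div_two]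
  linear_combination deriv h x * Real.sin_sq_add_cos_sq x

/-- The cotangent of the angle which the chord from `supportCurve h x` to `supportCurve h y` makes
with the tangent at its starting point: the quotient of the components of the chord along the
tangent and the inner normal at `supportCurve h x`. -/
def chordCot (h : ℝ → ℝ) (x y : ℝ) : ℝ :=
  height (x + Real.pi / 2) (supportCurve h y - supportCurve h x) /
    height x (supportCurve h x - supportCurve h y)

theorem chordCot_add_two_pi_right {h : ℝ → ℝ} (hh : Function.Periodic h (2 * Real.pi)) (x y : ℝ) :
    chordCot h x (y + 2 * Real.pi) = chordCot h x y := by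
  rw [chordCot, supportCurve_periodic_two_pi hh y, chordCot]

theorem continuous_height {α : Type*} [TopologicalSpace α] {X : α → ℝ} {z : α → ℂ}
    (hX : Continuous X) (hz : Continuous z) : Continuous fun t => height (X t) (z t) := by
  simp only [height_apply]
  fun_prop

theorem continuous_of_strictAntiOn {α : Type*} [TopologicalSpace α] {F : α → ℝ → ℝ}
    {a b Y : α → ℝ} (ha : Continuous a) (hb : Continuous b)
    (hF : ∀ t, ∀ y ∈ Ioo (a t) (b t), ContinuousAt (fun r => F r y) t)
    (hanti : ∀ t, StrictAntiOn (F t) (Ioo (a t) (b t))) (hY : ∀ t, Y t ∈ Ioo (a t) (b t))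
    (hFY : Continuous fun t => F t (Y t)) : Continuous Y := by
  refine continuous_iff_continuousAt.2 fun t => ?_
  have hmem : ∀ y ∈ Ioo (a t) (b t), ∀ᶠ r in 𝓝 t, y ∈ Ioo (a r) (b r) := fun y hy =>
    (ha.continuousAt.eventually_lt continuousAt_const hy.1).and
      (continuousAt_const.eventually_lt hb.continuousAt hy.2)
  refine tendsto_order.2 ⟨fun u hu => ?_, fun u hu => ?_⟩
  · obtain ⟨y, hy, hyY⟩ := exists_between (max_lt hu (hY t).1)
    obtain ⟨huy, hay⟩ := max_lt_iff.1 hy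
    have hyt : y ∈ Ioo (a t) (b t) := ⟨hay, hyY.trans (hY t).2⟩
    filter_upwards [hFY.continuousAt.eventually_lt (hF t y hyt) (hanti t hyt (hY t) hyY),
      hmem y hyt] with r hr hyr
    exact huy.trans (((hanti r).lt_iff_gt (hY r) hyr).1 hr)
  · obtain ⟨y, hYy, hy⟩ := exists_between (lt_min hu (hY t).2)
    obtain ⟨hyu, hyb⟩ := lt_min_iff.1 hy
    have hyt : y ∈ Ioo (a t) (b t) := ⟨(hY t).1.trans hYy, hyb⟩
    filter_upwards [(hF t y hyt).eventually_lt hFY.continuousAt (hanti t (hY t) hyt hYy),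
      hmem y hyt] with r hr hyr
    exact (((hanti r).lt_iff_gt hyr (hY r)).1 hr).trans hyu

namespace IsOvalSupport

variable {h : ℝ → ℝ}

theorem periodic_two_pi (hh : IsOvalSupport h) : Function.Periodic h (2 * Real.pi) :=
  mod_cast hh.periodic.nat_mul 2

theorem continuous_supportCurve (hh : IsOvalSupport h) : Continuous (supportCurve h) :=
  continuous_iff_continuousAt.2 fun x => (hh.hasDerivAt_supportCurve x).continuousAt

theorem supportCurve_antiperiodic (hh : IsOvalSupport h) :
    Function.Antiperiodic (supportCurve h) Real.pi := fun x => by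
  rw [supportCurve, hh.periodic, deriv_periodic hh.periodic, Complex.ofReal_add,
    add_mul (x : ℂ), Complex.exp_add, Complex.exp_pi_mul_I, mul_neg_one, mul_neg, supportCurve]

theorem chordCot_add_pi (hh : IsOvalSupport h) (x y : ℝ) :
    chordCot h (x + Real.pi) (y + Real.pi) = chordCot h x y := by
  rw [chordCot, add_right_comm, height_add_pi, height_add_pi, hh.supportCurve_antiperiodic,
    hh.supportCurve_antiperiodic, ← map_neg, ← map_neg]
  simp only [neg_sub_neg, neg_sub]
  rfl

theorem hasDerivAt_height_supportCurve (hh : IsOvalSupport h) (x y : ℝ) :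
    HasDerivAt (fun y => height x (supportCurve h y))
      ((h y + deriv (deriv h) y) * Real.sin (x - y)) y := by
  have hcomp := (height x).hasFDerivAt.comp_hasDerivAt y (hh.hasDerivAt_supportCurve y)
  rwa [← Complex.real_smul, map_smul, height_I_mul_exp, smul_eq_mul] at hcomp

theorem height_sub_pos (hh : IsOvalSupport h) {x y : ℝ} (hxy : x < y)
    (hyx : y < x + 2 * Real.pi) : 0 < height x (supportCurve h x - supportCurve h y) := by
  have hcont : Continuous fun y => height x (supportCurve h y) :=
    (height x).continuous.comp hh.continuous_supportCurve
  rw [map_sub, sub_pos]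
  rcases le_total y (x + Real.pi) with hy | hy
  · refine strictAntiOn_of_deriv_neg (convex_Icc x (x + Real.pi)) hcont.continuousOn
      (fun t ht => ?_) (left_mem_Icc.2 (hxy.le.trans hy)) ⟨hxy.le, hy⟩ hxy
    rw [interior_Icc] at ht
    rw [(hh.hasDerivAt_height_supportCurve x t).deriv]
    exact mul_neg_of_pos_of_neg (hh.radius_pos t)
      (Real.sin_neg_of_neg_of_neg_pi_lt (by linarith [ht.1]) (by linarith [ht.2]))
  · rw [← supportCurve_periodic_two_pi hh.periodic_two_pi x]
    refine strictMonoOn_of_deriv_pos (convex_Icc (x + Real.pi) (x + 2 * Real.pi))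
      hcont.continuousOn (fun t ht => ?_) ⟨hy, hyx.le⟩ (right_mem_Icc.2 (hy.trans hyx.le)) hyx
    rw [interior_Icc] at ht
    rw [(hh.hasDerivAt_height_supportCurve x t).deriv, ← Real.sin_add_two_pi]
    exact mul_pos (hh.radius_pos t)
      (Real.sin_pos_of_pos_of_lt_pi (by linarith [ht.2]) (by linarith [ht.1]))

theorem hasDerivAt_chordCot (hh : IsOvalSupport h) {x y : ℝ} (hxy : x < y)
    (hyx : y < x + 2 * Real.pi) :
    HasDerivAt (chordCot h x)
      (-((h y + deriv (deriv h) y) * height y (supportCurve h y - supportCurve h x)) /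
        height x (supportCurve h x - supportCurve h y) ^ 2) y := by
  have htangent := (hh.hasDerivAt_height_supportCurve (x + Real.pi / 2) y).sub_const
    (height (x + Real.pi / 2) (supportCurve h x))
  have hnormal := (hh.hasDerivAt_height_supportCurve x y).const_sub (height x (supportCurve h x))
  simp only [← map_sub] at htangent hnormal
  refine (htangent.fun_div hnormal (hh.height_sub_pos hxy hyx).ne').congr_deriv ?_
  rw [height_eq_cos_mul_add_sin_mul x y, add_sub_right_comm, Real.sin_add_pi_div_two,
    ← neg_sub y x, Real.sin_neg, Real.cos_neg, ← neg_sub (supportCurve h y), map_neg]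
  ring

theorem strictAntiOn_chordCot (hh : IsOvalSupport h) (x : ℝ) :
    StrictAntiOn (chordCot h x) (Ioo x (x + 2 * Real.pi)) := by
  refine strictAntiOn_of_deriv_neg (convex_Ioo _ _) (fun y hy =>
    (hh.hasDerivAt_chordCot hy.1 hy.2).continuousAt.continuousWithinAt) fun y hy => ?_
  rw [interior_Ioo] at hy
  rw [(hh.hasDerivAt_chordCot hy.1 hy.2).deriv, neg_div, neg_lt_zero]
  have hnormal : 0 < height y (supportCurve h y - supportCurve h x) := by
    rw [← supportCurve_periodic_two_pi hh.periodic_two_pi x]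
    exact hh.height_sub_pos hy.2 (by linarith [hy.1])
  exact div_pos (mul_pos (hh.radius_pos y) hnormal) (pow_pos (hh.height_sub_pos hy.1 hy.2) 2)

theorem strictAntiOn_chordCot_left (hh : IsOvalSupport h) (x : ℝ) :
    StrictAntiOn (chordCot h x) (Ioo (x - 2 * Real.pi) x) := by
  intro a ha b hb hab
  rw [← chordCot_add_two_pi_right hh.periodic_two_pi x a,
    ← chordCot_add_two_pi_right hh.periodic_two_pi x b]
  exact hh.strictAntiOn_chordCot x ⟨by linarith [ha.1], by linarith [ha.2]⟩
    ⟨by linarith [hb.1], by linarith [hb.2]⟩ (by linarith)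

theorem continuousAt_chordCot {α : Type*} [TopologicalSpace α] (hh : IsOvalSupport h)
    {X Y : α → ℝ} (hX : Continuous X) (hY : Continuous Y) {t : α} (hXY : X t < Y t)
    (hYX : Y t < X t + 2 * Real.pi) : ContinuousAt (fun r => chordCot h (X r) (Y r)) t := by
  have hcX := hh.continuous_supportCurve.comp hX
  have hcY := hh.continuous_supportCurve.comp hY
  exact (continuous_height (hX.add_const _) (hcY.sub hcX)).continuousAt.div
    (continuous_height hX (hcX.sub hcY)).continuousAt (hh.height_sub_pos hXY hYX).ne'

theorem continuous_chord_endpoint {α : Type*} [TopologicalSpace α] (hh : IsOvalSupport h)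
    {X Y : α → ℝ} (hX : Continuous X) (hY : ∀ t, Y t ∈ Ioo (X t) (X t + 2 * Real.pi))
    (hcot : Continuous fun t => chordCot h (X t) (Y t)) : Continuous Y :=
  continuous_of_strictAntiOn hX (hX.add_const _)
    (fun _ _ hy => hh.continuousAt_chordCot hX continuous_const hy.1 hy.2)
    (fun t => hh.strictAntiOn_chordCot (X t)) hY hcot

end IsOvalSupport

/-! ### Families of periodic orbits of a twist recurrence -/

/-- The recurrence `K x₁ x₂ + K x₁ x₀ = 0` on the line, of which the angles of the normals along a
billiard orbit are a solution, has the twist property: its orbits advance by less than `L` in each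
step, and in this range `K` is decreasing in its second argument. -/
structure IsTwist (L : ℝ) (K : ℝ → ℝ → ℝ) : Prop where
  strictAntiOn_right : ∀ x, StrictAntiOn (K x) (Ioo x (x + L))
  strictAntiOn_left : ∀ x, StrictAntiOn (K x) (Ioo (x - L) x)

/-- The orbits of the recurrence `K x₁ x₂ + K x₁ x₀ = 0`. -/
structure IsTwistOrbit (L : ℝ) (K : ℝ → ℝ → ℝ) (x : ℤ → ℝ) : Prop where
  lt : ∀ n, x n < x (n + 1)
  lt_add : ∀ n, x (n + 1) < x n + L
  reflect : ∀ n, K (x n) (x (n + 1)) + K (x n) (x (n - 1)) = 0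

/-- The lift of a circle homeomorphism whose orbits are orbits of the recurrence
`K x₁ x₂ + K x₁ x₀ = 0`. -/
structure IsTwistMap (L : ℝ) (K : ℝ → ℝ → ℝ) (f : ℝ ≃o ℝ) : Prop where
  lt : ∀ x, x < f x
  lt_add : ∀ x, f x < x + L
  reflect : ∀ x, K x (f x) + K x (f.symm x) = 0

/-- A closed curve, parametrized with period `1`, of orbits `n ↦ X n t` of period `N` which turn
once around the circle of length `L`.  The curve is simple and is invariant under the shift. -/
structure IsOrbitFamily (L : ℝ) (K : ℝ → ℝ → ℝ) (N : ℕ) (X : ℤ → ℝ → ℝ) : Prop where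
  orbit : ∀ t, IsTwistOrbit L K fun n => X n t
  continuous_nat : ∀ i : ℕ, Continuous (X i)
  period : ∀ n t, X (n + N) t = X n t + L
  turn : ∀ n t, X n (t + 1) = X n t + L
  inj : ∀ t t', (∀ n, X n t = X n t') → t = t'
  shift : ∀ t, ∃ t', ∀ n, X n t' = X (n + 1) t

section Twist

variable {L : ℝ} {K : ℝ → ℝ → ℝ}

theorem IsTwist.lt_iff_lt (hK : IsTwist L K) {p u u' v v' : ℝ} (hu : u ∈ Ioo p (p + L))
    (hu' : u' ∈ Ioo p (p + L)) (hv : v ∈ Ioo (p - L) p) (hv' : v' ∈ Ioo (p - L) p)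
    (h : K p u + K p v = 0) (h' : K p u' + K p v' = 0) : u < u' ↔ v' < v := by
  rw [← (hK.strictAntiOn_right p).lt_iff_gt hu' hu, ← (hK.strictAntiOn_left p).lt_iff_gt hv hv',
    eq_neg_of_add_eq_zero_left h, eq_neg_of_add_eq_zero_left h', neg_lt_neg_iff]

namespace IsTwistOrbit

variable {x y : ℤ → ℝ}

theorem mem_right (hx : IsTwistOrbit L K x) (n : ℤ) : x (n + 1) ∈ Ioo (x n) (x n + L) :=
  ⟨hx.lt n, hx.lt_add n⟩

theorem mem_left (hx : IsTwistOrbit L K x) (n : ℤ) : x (n - 1) ∈ Ioo (x n - L) (x n) := by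
  have hlt := hx.lt (n - 1)
  have hlt_add := hx.lt_add (n - 1)
  rw [sub_add_cancel] at hlt hlt_add
  exact ⟨sub_lt_iff_lt_add.2 hlt_add, hlt⟩

theorem eq_neighbors_of_le (hK : IsTwist L K) (hx : IsTwistOrbit L K x) (hy : IsTwistOrbit L K y)
    (hle : ∀ n, x n ≤ y n) {n : ℤ} (hn : x n = y n) :
    x (n + 1) = y (n + 1) ∧ x (n - 1) = y (n - 1) := by
  have hiff : x (n + 1) < y (n + 1) ↔ y (n - 1) < x (n - 1) :=
    hK.lt_iff_lt (hx.mem_right n) (hn ▸ hy.mem_right n) (hx.mem_left n) (hn ▸ hy.mem_left n)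
      (hx.reflect n) (hn ▸ hy.reflect n)
  have hiff' : y (n + 1) < x (n + 1) ↔ x (n - 1) < y (n - 1) :=
    hK.lt_iff_lt (hn ▸ hy.mem_right n) (hx.mem_right n) (hn ▸ hy.mem_left n) (hx.mem_left n)
      (hn ▸ hy.reflect n) (hx.reflect n)
  exact ⟨(hle _).eq_of_not_lt fun h => (hiff.1 h).not_ge (hle _),
    (hle _).eq_of_not_lt fun h => (hiff'.2 h).not_ge (hle _)⟩

theorem eq_of_le (hK : IsTwist L K) (hx : IsTwistOrbit L K x) (hy : IsTwistOrbit L K y)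
    (hle : ∀ n, x n ≤ y n) {m : ℤ} (hm : x m = y m) (n : ℤ) : x n = y n := by
  induction n using Int.inductionOn' (b := m) with
  | zero => exact hm
  | succ n _ ih => exact (hx.eq_neighbors_of_le hK hy hle ih).1
  | pred n _ ih => exact (hx.eq_neighbors_of_le hK hy hle ih).2

end IsTwistOrbit

namespace IsTwistMap

variable {f g : ℝ ≃o ℝ}

theorem mem_right (hf : IsTwistMap L K f) (x : ℝ) : f x ∈ Ioo x (x + L) :=
  ⟨hf.lt x, hf.lt_add x⟩

theorem mem_left (hf : IsTwistMap L K f) (x : ℝ) : f.symm x ∈ Ioo (x - L) x := by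
  have hmem := hf.mem_right (f.symm x)
  rw [f.apply_symm_apply] at hmem
  exact ⟨sub_lt_iff_lt_add.2 hmem.2, hmem.1⟩

theorem apply_lt_apply (hK : IsTwist L K) (hf : IsTwistMap L K f) (hg : IsTwistMap L K g) {x : ℝ}
    (hx : g x < f x) : g (f x) < f (f x) := by
  refine (hK.lt_iff_lt (hg.mem_right _) (hf.mem_right _) (hg.mem_left _) (hf.mem_left _)
    (hg.reflect _) (hf.reflect _)).2 ?_
  rwa [f.symm_apply_apply, g.lt_symm_apply]

theorem apply_le_of_iterate_eq (hK : IsTwist L K) (hf : IsTwistMap L K f)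
    (hg : IsTwistMap L K g) {n : ℕ} (hn : n ≠ 0) {x : ℝ} (hfg : f^[n] x = g^[n] x) :
    f x ≤ g x := by
  by_contra! hlt
  have hadvance : ∀ k, g (f^[k] x) < f (f^[k] x) := fun k => by
    induction k with
    | zero => exact hlt
    | succ k ih =>
      rw [Function.iterate_succ_apply']
      exact hf.apply_lt_apply hK hg ih
  have hlag : ∀ k, g^[k] x ≤ f^[k] x := fun k => by
    induction k with
    | zero => exact le_rfl
    | succ k ih =>
      rw [Function.iterate_succ_apply', Function.iterate_succ_apply']
      exact (g.monotone ih).trans (hadvance k).le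
  obtain ⟨k, rfl⟩ := Nat.exists_eq_succ_of_ne_zero hn
  rw [Function.iterate_succ_apply', Function.iterate_succ_apply'] at hfg
  exact ((g.monotone (hlag k)).trans_lt (hadvance k)).ne hfg.symm

theorem map_add_of_iterate_eq (hK : IsTwist L K) (hf : IsTwistMap L K f) {a b : ℝ} {n : ℕ}
    (hn : n ≠ 0) (hiter : ∀ x, f^[n] x = x + b) (ha : ∀ x y, K (x + a) (y + a) = K x y) (x : ℝ) :
    f (x + a) = f x + a := by
  set g : ℝ ≃o ℝ := ((OrderIso.addRight a).trans f).trans (OrderIso.addRight a).symm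
  have hg_apply : ∀ y, g y = f (y + a) - a := fun y => (sub_eq_add_neg _ _).symm
  have hg : IsTwistMap L K g := by
    refine ⟨fun y => ?_, fun y => ?_, fun y => ?_⟩
    · linarith [hf.lt (y + a), hg_apply y]
    · linarith [hf.lt_add (y + a), hg_apply y]
    · have hg_symm : g.symm y = f.symm (y + a) - a := (sub_eq_add_neg _ _).symm
      rw [hg_apply, hg_symm, ← ha, ← ha y, sub_add_cancel, sub_add_cancel]
      exact hf.reflect _
  have hg_iter : ∀ y, g^[n] y = y + b := fun y => by
    have hconj : Function.Semiconj (· + a) g f := fun y => by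
      simp only [hg_apply, sub_add_cancel]
    linarith [(hconj.iterate_right n) y, hiter (y + a)]
  have heq : f x = g x :=
    (hf.apply_le_of_iterate_eq hK hg hn ((hiter x).trans (hg_iter x).symm)).antisymm
      (hg.apply_le_of_iterate_eq hK hf hn ((hg_iter x).trans (hiter x).symm))
  linarith [hg_apply x]

end IsTwistMap

namespace IsOrbitFamily

variable {N : ℕ} {X : ℤ → ℝ → ℝ}

theorem exists_eq_add_zsmul (hX : IsOrbitFamily L K N X) (hN : N ≠ 0) (n : ℤ) :
    ∃ i < N, ∃ k : ℤ, ∀ t, X n t = X i t + k • L := by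
  have hpos : (0 : ℤ) < N := mod_cast Nat.pos_of_ne_zero hN
  obtain ⟨i, hi⟩ := Int.eq_ofNat_of_zero_le (Int.emod_nonneg n hpos.ne')
  refine ⟨i, by exact_mod_cast hi ▸ Int.emod_lt_of_pos n hpos, n / N, fun t => ?_⟩
  rw [← map_add_zsmul_of_map_add (f := fun n => X n t) (hX.period · t), ← hi, smul_eq_mul,
    Int.emod_add_ediv_mul]

theorem continuous (hX : IsOrbitFamily L K N X) (hN : N ≠ 0) (n : ℤ) : Continuous (X n) := by
  obtain ⟨i, -, k, hk⟩ := hX.exists_eq_add_zsmul hN n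
  rw [funext hk]
  exact (hX.continuous_nat i).add_const _

theorem forall_lt_iff (hX : IsOrbitFamily L K N X) (hN : N ≠ 0) {s t : ℝ} :
    (∀ n, X n s < X n t) ↔ ∀ i ∈ Finset.range N, X i s < X i t := by
  refine ⟨fun h i _ => h i, fun h n => ?_⟩
  obtain ⟨i, hi, k, hk⟩ := hX.exists_eq_add_zsmul hN n
  simpa only [hk, add_lt_add_iff_right] using h i (Finset.mem_range.2 hi)

theorem pos (hX : IsOrbitFamily L K N X) : 0 < L := by
  linarith [(hX.orbit 0).lt 0, (hX.orbit 0).lt_add 0]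

/-- The pairs of parameters whose orbits are ordered form an open and closed subset of the half
plane `s < t`: where the order is about to fail, two orbits touch. -/
theorem strictMono (hK : IsTwist L K) (hX : IsOrbitFamily L K N X) (hN : N ≠ 0) (n : ℤ) :
    StrictMono (X n) := by
  set S : Set (ℝ × ℝ) := {p | p.1 < p.2}
  set U : Set (ℝ × ℝ) := {p | ∀ n, X n p.1 < X n p.2}
  have hfst : ∀ n, Continuous fun p : ℝ × ℝ => X n p.1 := fun n =>
    (hX.continuous hN n).comp continuous_fst
  have hsnd : ∀ n, Continuous fun p : ℝ × ℝ => X n p.2 := fun n =>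
    (hX.continuous hN n).comp continuous_snd
  have hconn : IsPreconnected S := by
    have hlin : IsLinearMap ℝ fun p : ℝ × ℝ => p.1 - p.2 :=
      (LinearMap.fst ℝ ℝ ℝ - LinearMap.snd ℝ ℝ ℝ).isLinear
    simpa only [sub_neg] using (convex_halfSpace_lt hlin 0).isPreconnected
  have hopen : IsOpen U := by
    have hU : U = ⋂ i ∈ Finset.range N, {p | X i p.1 < X i p.2} := by
      ext p
      rw [mem_iInter₂]
      exact hX.forall_lt_iff hN
    exact hU ▸ isOpen_biInter_finset fun i _ => isOpen_lt (hfst i) (hsnd i)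
  have hclosed : closure U ∩ S ⊆ U := by
    rintro ⟨s, t⟩ ⟨hU, hst⟩ n
    have hle : ∀ n, X n s ≤ X n t := fun n =>
      closure_minimal (fun p hp => (hp n).le) (isClosed_le (hfst n) (hsnd n)) hU
    exact (hle n).lt_of_ne fun heq => hst.ne
      (hX.inj s t ((hX.orbit s).eq_of_le hK (hX.orbit t) hle heq))
  have hmeet : (S ∩ U).Nonempty := ⟨(0, 0 + 1), by simp [S], fun n => by
    linarith [hX.turn n 0, hX.pos]⟩
  exact fun s t hst => hconn.subset_of_closure_inter_subset hopen hmeet hclosed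
    (show (s, t) ∈ S from hst) n

theorem surjective (hX : IsOrbitFamily L K N X) (hN : N ≠ 0) (n : ℤ) :
    Function.Surjective (X n) :=
  surjective_of_add_eq (hX.continuous hN n) one_pos hX.pos (hX.turn n)

theorem exists_isTwistMap (hK : IsTwist L K) (hX : IsOrbitFamily L K N X) (hN : N ≠ 0) :
    ∃ f : ℝ ≃o ℝ, IsTwistMap L K f ∧ (∀ (n : ℕ) t, f (X n t) = X (n + 1) t) ∧
      ∀ x, f^[N] x = x + L := by
  have hsurj := hX.surjective hN
  have hiso : ∀ n, ∃ e : ℝ ≃o ℝ, ∀ t, e t = X n t := fun n =>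
    ⟨(hX.strictMono hK hN n).orderIsoOfSurjective _ (hsurj n), fun _ => rfl⟩
  obtain ⟨e₀, he₀⟩ := hiso 0
  obtain ⟨e₁, he₁⟩ := hiso 1
  set f := e₀.symm.trans e₁
  have hf : ∀ (n : ℕ) t, f (X n t) = X (n + 1) t := fun n => by
    induction n with
    | zero => exact fun t => by rw [Nat.cast_zero, zero_add, ← he₁, ← he₀,
        OrderIso.trans_apply, e₀.symm_apply_apply]
    | succ n ih =>
      intro t
      obtain ⟨t', ht'⟩ := hX.shift t
      rw [Nat.cast_succ, ← ht', ← ht', ih]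
  have hf₀ : ∀ t, f (X 0 t) = X 1 t := hf 0
  refine ⟨f, ⟨(hsurj 0).forall.2 fun t => ?_, (hsurj 0).forall.2 fun t => ?_,
    (hsurj 1).forall.2 fun t => ?_⟩, hf, (hsurj 0).forall.2 fun t => ?_⟩
  · exact (hf₀ t).symm ▸ (hX.orbit t).lt 0
  · exact (hf₀ t).symm ▸ (hX.orbit t).lt_add 0
  · have hf₁ : f (X 1 t) = X (1 + 1) t := hf 1 t
    rw [hf₁, f.symm_apply_eq.2 (hf₀ t).symm]
    exact (hX.orbit t).reflect 1
  · have hiter : ∀ n : ℕ, f^[n] (X 0 t) = X n t := fun n => by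
      induction n with
      | zero => rfl
      | succ n ih => rw [Function.iterate_succ_apply', ih, hf, Nat.cast_succ]
    rw [hiter, ← hX.period, zero_add]

end IsOrbitFamily

end Twist

/-! ### Billiard orbits as twist orbits -/

theorem injOn_cot : InjOn Real.cot (Ioo 0 Real.pi) := by
  intro a ha b hb hab
  rw [Real.cot_eq_cos_div_sin, Real.cot_eq_cos_div_sin,
    div_eq_div_iff (Real.sin_pos_of_mem_Ioo ha).ne' (Real.sin_pos_of_mem_Ioo hb).ne'] at hab
  have hsin : Real.sin (a - b) = 0 := by rw [Real.sin_sub]; linarith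
  linarith [(Real.sin_eq_zero_iff_of_lt_of_lt (by linarith [ha.1, hb.2])
    (by linarith [ha.2, hb.1])).1 hsin]

theorem eq_mul_of_tendsto_div {x : ℕ → ℝ} {a r : ℝ} {N : ℕ} (hN : N ≠ 0)
    (hx : ∀ n, x (n + N) = x n + a)
    (hr : Tendsto (fun n : ℕ => (x n - x 0) / n) atTop (𝓝 r)) : a = N * r := by
  have hmul : ∀ m : ℕ, x (m * N) = x 0 + m * a := fun m => by
    induction m with
    | zero => simp only [zero_mul, Nat.cast_zero, add_zero]
    | succ m ih => rw [Nat.succ_mul, hx, ih]; push_cast; ring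
  have hsub : Tendsto (fun m : ℕ => (m + 1) * N) atTop atTop :=
    tendsto_atTop_mono (fun m => m.le_succ.trans (Nat.le_mul_of_pos_right _ (by positivity)))
      tendsto_id
  have hconst : ((fun n : ℕ => (x n - x 0) / n) ∘ fun m : ℕ => (m + 1) * N) = fun _ => a / N := by
    ext m
    have hm : ((m + 1 : ℕ) : ℝ) ≠ 0 := by positivity
    simp only [Function.comp_apply, hmul, Nat.cast_mul, add_sub_cancel_left]
    exact mul_div_mul_left _ _ hm
  have hlim := hr.comp hsub
  rw [hconst] at hlim
  rw [← tendsto_nhds_unique hlim tendsto_const_nhds |>.symm]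
  field_simp

theorem apply_eq_add_of_apply_apply {g : ℝ → ℝ} (hg : StrictMono g) {a : ℝ}
    (ha : ∀ x, g (x + a) = g x + a) (hgg : ∀ x, g (g x) = x + 2 * a) (x : ℝ) : g x = x + a := by
  rcases lt_trichotomy (g x) (x + a) with h | h | h
  · linarith [hg h, ha x, hgg x]
  · exact h
  · linarith [hg h, ha x, hgg x]

section Billiard

variable {γ : ℝ → ℂ} {P : ℝ} {ψ : ℝ ≃o ℝ}

namespace IsTable

theorem chordCot_eq_cot (hγ : IsTable γ P) (hψ : IsNormalAngle γ ψ) {s t r δ : ℝ} (hr : r ≠ 0)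
    (h : γ t - γ s = r * (Complex.exp (δ * Complex.I) * deriv γ s)) :
    chordCot (supportFunction γ) (ψ s) (ψ t) = Real.cot δ := by
  have hchord : γ t - γ s = r • (Complex.I * Complex.exp ((ψ s + δ : ℝ) * Complex.I)) := by
    rw [h, (hψ.hasDerivAt_curve s).deriv, Complex.real_smul, Complex.ofReal_add,
      add_mul (ψ s : ℂ), Complex.exp_add]
    ring
  rw [chordCot, ← hγ.curve_eq_supportCurve hψ, ← hγ.curve_eq_supportCurve hψ,
    ← neg_sub (γ t) (γ s), map_neg, hchord, map_smul, map_smul, height_I_mul_exp,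
    height_I_mul_exp, add_sub_add_left_eq_sub, sub_add_cancel_left, Real.sin_neg,
    Real.sin_pi_div_two_sub, smul_neg, neg_neg, smul_eq_mul, smul_eq_mul, mul_div_mul_left _ _ hr,
    Real.cot_eq_cos_div_sin]

theorem curve_ne (hγ : IsTable γ P) {s t : ℝ} (hst : s < t) (hts : t < s + P) : γ t ≠ γ s := by
  intro h
  obtain ⟨n, rfl⟩ := exists_eq_add_zsmul_of_injOn_Ico hγ.pos hγ.periodic hγ.simple h
  rw [lt_add_iff_pos_right, zsmul_eq_mul, mul_pos_iff_of_pos_right hγ.pos, Int.cast_pos] at hst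
  rw [add_lt_add_iff_left, zsmul_eq_mul, mul_lt_iff_lt_one_left hγ.pos] at hts
  have hn : n < 1 := mod_cast hts
  omega

end IsTable

namespace Step

variable {z z₁ w w₁ : ℝ × ℝ}

theorem norm_ne_zero (hγ : IsTable γ P) (h : Step γ P z z₁) : ‖γ z₁.1 - γ z.1‖ ≠ 0 := by
  obtain ⟨-, -, hlt, hlt_add, -⟩ := h
  exact norm_ne_zero_iff.2 (sub_ne_zero.2 (hγ.curve_ne hlt hlt_add))

theorem angle_mem (hγ : IsTable γ P) (hψ : IsNormalAngle γ ψ) (h : Step γ P z z₁) :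
    ψ z₁.1 ∈ Ioo (ψ z.1) (ψ z.1 + 2 * Real.pi) := by
  obtain ⟨-, -, hlt, hlt_add, -⟩ := h
  exact ⟨ψ.strictMono hlt, hγ.angle_add_period hψ z.1 ▸ ψ.strictMono hlt_add⟩

theorem chordCot_right (hγ : IsTable γ P) (hψ : IsNormalAngle γ ψ) (h : Step γ P z z₁) :
    chordCot (supportFunction γ) (ψ z.1) (ψ z₁.1) = Real.cot z.2 := by
  obtain ⟨-, -, -, -, hchord, -⟩ := id h
  exact hγ.chordCot_eq_cot hψ (h.norm_ne_zero hγ) hchord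

theorem chordCot_left (hγ : IsTable γ P) (hψ : IsNormalAngle γ ψ) (h : Step γ P z z₁) :
    chordCot (supportFunction γ) (ψ z₁.1) (ψ z.1) = -Real.cot z₁.2 := by
  obtain ⟨-, -, -, -, -, hchord⟩ := id h
  have hrev : γ z.1 - γ z₁.1 = ((-‖γ z₁.1 - γ z.1‖ : ℝ) : ℂ) *
      (Complex.exp ((-z₁.2 : ℝ) * Complex.I) * deriv γ z₁.1) := by
    rw [Complex.ofReal_neg, Complex.ofReal_neg, neg_mul (z₁.2 : ℂ), neg_mul, ← hchord, neg_sub]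
  rw [hγ.chordCot_eq_cot hψ (neg_ne_zero.2 (h.norm_ne_zero hγ)) hrev, Real.cot_eq_cos_div_sin,
    Real.cot_eq_cos_div_sin, Real.cos_neg, Real.sin_neg, div_neg]

theorem angle_sub (hγ : IsTable γ P) (hψ : IsNormalAngle γ ψ) (h : Step γ P z z₁) :
    ψ z₁.1 - ψ z.1 = z.2 + z₁.2 := by
  obtain ⟨hz, hz₁, -, -, hchord, hchord₁⟩ := id h
  have hmem := h.angle_mem hγ hψ
  have hdir := mul_left_cancel₀ (Complex.ofReal_ne_zero.2 (h.norm_ne_zero hγ))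
    (hchord.symm.trans hchord₁)
  rw [(hψ.hasDerivAt_curve _).deriv, (hψ.hasDerivAt_curve _).deriv, mul_left_comm,
    mul_left_comm _ Complex.I, mul_right_inj' Complex.I_ne_zero, ← Complex.exp_add,
    ← Complex.exp_add, eq_comm, Complex.exp_eq_exp_iff_exp_sub_eq_one] at hdir
  have hcos : Real.cos (ψ z₁.1 - ψ z.1 - (z.2 + z₁.2)) = 1 := by
    rw [← Complex.exp_ofReal_mul_I_re, ← Complex.one_re, ← hdir]
    push_cast
    ring_nf
  rw [Real.cos_eq_one_iff_of_lt_of_lt (by linarith [hmem.1, hz.2, hz₁.2])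
    (by linarith [hmem.2, hz.1, hz₁.1])] at hcos
  linarith

theorem eq_right (hγ : IsTable γ P) (hψ : IsNormalAngle γ ψ) (h : Step γ P z z₁)
    (h' : Step γ P z w₁) : z₁ = w₁ := by
  have hcot := (h.chordCot_right hγ hψ).trans (h'.chordCot_right hγ hψ).symm
  have hangle := (hγ.isOvalSupport.strictAntiOn_chordCot (ψ z.1)).injOn (h.angle_mem hγ hψ)
    (h'.angle_mem hγ hψ) hcot
  have hsub := h.angle_sub hγ hψ
  rw [hangle, h'.angle_sub hγ hψ] at hsub
  exact Prod.ext (ψ.injective hangle) (by linarith)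

theorem eq_left (hγ : IsTable γ P) (hψ : IsNormalAngle γ ψ) (h : Step γ P z z₁)
    (h' : Step γ P w z₁) : z = w := by
  have hcot := (h.chordCot_left hγ hψ).trans (h'.chordCot_left hγ hψ).symm
  have hmem := h.angle_mem hγ hψ
  have hmem' := h'.angle_mem hγ hψ
  have hangle := (hγ.isOvalSupport.strictAntiOn_chordCot_left (ψ z₁.1)).injOn
    ⟨by linarith [hmem.2], hmem.1⟩ ⟨by linarith [hmem'.2], hmem'.1⟩ hcot
  have hsub := h.angle_sub hγ hψ
  rw [hangle, h'.angle_sub hγ hψ] at hsub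
  exact Prod.ext (ψ.injective hangle) (by linarith)

theorem add_period (hγ : IsTable γ P) (h : Step γ P z z₁) :
    Step γ P (z + (P, 0)) (z₁ + (P, 0)) := by
  obtain ⟨hz, hz₁, hlt, hlt_add, hchord, hchord₁⟩ := h
  simp only [Step, Prod.fst_add, Prod.snd_add, add_zero, hγ.periodic _,
    deriv_periodic hγ.periodic _]
  exact ⟨hz, hz₁, add_lt_add_left hlt P, by linarith, hchord, hchord₁⟩

end Step

namespace IsOrbit

variable {z w : ℤ → ℝ × ℝ}

theorem ext (hγ : IsTable γ P) (hψ : IsNormalAngle γ ψ) (hz : IsOrbit γ P z)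
    (hw : IsOrbit γ P w) (h : z 0 = w 0) : z = w := by
  funext n
  induction n with
  | zero => exact h
  | succ n ih => exact (hz n).eq_right hγ hψ (ih ▸ hw n)
  | pred n ih =>
    have hz' := hz (-n - 1)
    have hw' := hw (-n - 1)
    rw [sub_add_cancel] at hz' hw'
    exact hz'.eq_left hγ hψ (ih ▸ hw')

theorem shift (hz : IsOrbit γ P z) : IsOrbit γ P fun n => z (n + 1) := fun n => hz (n + 1)

theorem add_period (hγ : IsTable γ P) (hz : IsOrbit γ P z) :
    IsOrbit γ P fun n => z n + (P, 0) := fun n => (hz n).add_period hγ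

theorem isTwistOrbit (hγ : IsTable γ P) (hψ : IsNormalAngle γ ψ) (hz : IsOrbit γ P z) :
    IsTwistOrbit (2 * Real.pi) (chordCot (supportFunction γ)) fun n => ψ (z n).1 where
  lt n := ((hz n).angle_mem hγ hψ).1
  lt_add n := ((hz n).angle_mem hγ hψ).2
  reflect n := by
    have hleft := (hz (n - 1)).chordCot_left hγ hψ
    rw [sub_add_cancel] at hleft
    rw [hleft, (hz n).chordCot_right hγ hψ, add_neg_cancel]

theorem period_eq_mul_rotationNumber (hP : P ≠ 0) {N : ℕ} (hN : N ≠ 0) {k r : ℝ}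
    (hk : ∀ n, z (n + N) = z n + (k * P, 0))
    (hr : Tendsto (fun n : ℕ => ((z n).1 - (z 0).1) / (n * P)) atTop (𝓝 r)) : k = N * r := by
  refine eq_mul_of_tendsto_div (x := fun n => (z n).1 / P) hN (fun n => ?_) (hr.congr fun n => ?_)
  · rw [Nat.cast_add, hk, Prod.fst_add, add_div, mul_div_cancel_right₀ _ hP]
  · rw [← sub_div, div_div, mul_comm P, Nat.cast_zero]

end IsOrbit

theorem IsTable.isTwist (hγ : IsTable γ P) :
    IsTwist (2 * Real.pi) (chordCot (supportFunction γ)) :=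
  ⟨hγ.isOvalSupport.strictAntiOn_chordCot, hγ.isOvalSupport.strictAntiOn_chordCot_left⟩

theorem IsOrbit.continuous_angle_and_cot (hγ : IsTable γ P) (hψ : IsNormalAngle γ ψ)
    {z : ℝ → ℤ → ℝ × ℝ} (hz : ∀ t, IsOrbit γ P (z t)) (hcont : Continuous fun t => z t 0) (i : ℕ) :
    Continuous (fun t => ψ (z t i).1) ∧ Continuous fun t => Real.cot (z t i).2 := by
  have hh := hγ.isOvalSupport
  induction i with
  | zero =>
    simp only [Nat.cast_zero, Real.cot_eq_cos_div_sin]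
    exact ⟨hψ.continuous.comp hcont.fst, (Real.continuous_cos.comp hcont.snd).div
      (Real.continuous_sin.comp hcont.snd) fun t => (Real.sin_pos_of_mem_Ioo (hz t 0).1).ne'⟩
  | succ i ih =>
    have hmem := fun t => (hz t i).angle_mem hγ hψ
    have hangle : Continuous fun t => ψ (z t (i + 1)).1 :=
      hh.continuous_chord_endpoint ih.1 hmem
        (ih.2.congr fun t => ((hz t i).chordCot_right hγ hψ).symm)
    have hchord : Continuous fun t =>
        chordCot (supportFunction γ) (ψ (z t (i + 1)).1) (ψ (z t i).1 + 2 * Real.pi) :=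
      continuous_iff_continuousAt.2 fun t => hh.continuousAt_chordCot hangle
        (ih.1.add_const _) (hmem t).2 (add_lt_add_left (hmem t).1 _)
    refine ⟨mod_cast hangle, hchord.neg.congr fun t => ?_⟩
    rw [Pi.neg_apply, chordCot_add_two_pi_right hh.periodic_two_pi,
      (hz t i).chordCot_left hγ hψ, neg_neg, Nat.cast_succ]

theorem IsTable.isOrbitFamily (hγ : IsTable γ P) (hψ : IsNormalAngle γ ψ) {N : ℕ}
    {z : ℝ → ℤ → ℝ × ℝ} (hz : ∀ t, IsOrbit γ P (z t)) (hcont : Continuous fun t => z t 0)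
    (hper : ∀ t n, z t (n + N) = z t n + (P, 0)) (hturn : ∀ t, z (t + 1) 0 = z t 0 + (P, 0))
    (hinj : Function.Injective fun t => z t 0) (hshift : ∀ t, ∃ t', z t' 0 = z t 1) :
    IsOrbitFamily (2 * Real.pi) (chordCot (supportFunction γ)) N fun n t => ψ (z t n).1 where
  orbit t := (hz t).isTwistOrbit hγ hψ
  continuous_nat i := (IsOrbit.continuous_angle_and_cot hγ hψ hz hcont i).1
  period n t := by rw [hper, Prod.fst_add, hγ.angle_add_period hψ]
  turn n t := by
    rw [(hz (t + 1)).ext hγ hψ ((hz t).add_period hγ) (hturn t), Prod.fst_add,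
      hγ.angle_add_period hψ]
  inj t t' h := by
    have hcot : Real.cot (z t 0).2 = Real.cot (z t' 0).2 := by
      rw [← (hz t 0).chordCot_right hγ hψ, ← (hz t' 0).chordCot_right hγ hψ, h 0, h (0 + 1)]
    exact hinj (Prod.ext (ψ.injective (h 0)) (injOn_cot (hz t 0).1 (hz t' 0).1 hcot))
  shift t := by
    obtain ⟨t', ht'⟩ := hshift t
    exact ⟨t', fun n => by rw [(hz t').ext hγ hψ (hz t).shift ht']⟩

variable {α : Set (ℝ × ℝ)}

theorem IsTable.exists_isTwistMap (hγ : IsTable γ P) (hψ : IsNormalAngle γ ψ) {N : ℕ} (hN : N ≠ 0)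
    (hα : IsRotationalCurve P α) (hper : ConsistsOfPeriodicOrbits γ P N α)
    (hrot : HasRotationNumber γ P α (1 / N)) :
    ∃ f : ℝ ≃o ℝ, IsTwistMap (2 * Real.pi) (chordCot (supportFunction γ)) f ∧
      (∀ x, f^[N] x = x + 2 * Real.pi) ∧ (∀ z ∈ α, ∀ z₁, Step γ P z z₁ → f (ψ z.1) = ψ z₁.1) ∧
      ∀ x, ∃ z ∈ α, ψ z.1 = x := by
  obtain ⟨c, hc, rfl, -, hturn, hinj⟩ := hα
  choose z hz hz₀ hzα hzk using fun t => hper (c t) (mem_range_self t)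
  have hperiod : ∀ t n, z t (n + N) = z t n + (P, 0) := fun t n => by
    obtain ⟨k, hk⟩ := hzk t
    have hk₁ := IsOrbit.period_eq_mul_rotationNumber hγ.pos.ne' hN hk
      (hrot (z t) (hz t) (hzα t 0))
    rw [hk, hk₁, mul_one_div_cancel (Nat.cast_ne_zero.2 hN), one_mul]
  have hinj₀ : Function.Injective c := fun t t' h => by
    simpa only [Int.cast_zero, add_zero] using
      hinj t' t 0 (by rw [h, Int.cast_zero, zero_mul, Prod.mk_zero_zero, add_zero])
  obtain rfl : c = fun t => z t 0 := (funext hz₀).symm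
  have hX := hγ.isOrbitFamily hψ hz hc hperiod hturn hinj₀ fun t => hzα t 1
  obtain ⟨f, hf, hstep, hiter⟩ := hX.exists_isTwistMap hγ.isTwist hN
  refine ⟨f, hf, hiter, forall_mem_range.2 fun t z₁ h => ?_, fun x => ?_⟩
  · rw [(hz t 0).eq_right hγ hψ h |>.symm]
    exact hstep 0 t
  · obtain ⟨t, ht⟩ := hX.surjective hN 0 x
    exact ⟨_, mem_range_self t, ht⟩

theorem Step.angle_eq_add_pi_div_two (hγ : IsTable γ P) (hψ : IsNormalAngle γ ψ)
    {z₀ z₁ z₂ z₃ : ℝ × ℝ} (h₀ : Step γ P z₀ z₁) (h₁ : Step γ P z₁ z₂) (h₂ : Step γ P z₂ z₃)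
    (hz₂ : ψ z₂.1 = ψ z₀.1 + Real.pi) (hz₃ : ψ z₃.1 = ψ z₁.1 + Real.pi) :
    ψ z₁.1 = ψ z₀.1 + Real.pi / 2 := by
  have hcot : Real.cot z₂.2 = Real.cot z₀.2 := by
    rw [← h₂.chordCot_right hγ hψ, ← h₀.chordCot_right hγ hψ, hz₂, hz₃,
      hγ.isOvalSupport.chordCot_add_pi]
  have hsnd : z₂.2 = z₀.2 := injOn_cot h₂.1 h₀.1 hcot
  linarith [h₀.angle_sub hγ hψ, h₁.angle_sub hγ hψ]

theorem IsTable.exists_quarter_turn (hγ : IsTable γ P) (hψ : IsNormalAngle γ ψ)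
    (hα : IsRotationalCurve P α) (hper : ConsistsOfPeriodicOrbits γ P 4 α)
    (hrot : HasRotationNumber γ P α (1 / 4)) :
    ∃ f : ℝ ≃o ℝ, IsTwistMap (2 * Real.pi) (chordCot (supportFunction γ)) f ∧
      (∀ x, f x = x + Real.pi / 2) ∧ (∀ z ∈ α, ∀ z₁, Step γ P z z₁ → f (ψ z.1) = ψ z₁.1) ∧
      ∀ x, ∃ z ∈ α, ψ z.1 = x := by
  obtain ⟨f, hf, hiter, hstep, hsurj⟩ := hγ.exists_isTwistMap hψ four_ne_zero hα hper
    (by exact_mod_cast hrot)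
  have hcomm := hf.map_add_of_iterate_eq hγ.isTwist four_ne_zero hiter
    hγ.isOvalSupport.chordCot_add_pi
  have hhalf : ∀ x, f (f x) = x + Real.pi :=
    apply_eq_add_of_apply_apply (f.strictMono.comp f.strictMono)
      (fun x => by simp only [Function.comp_apply, hcomm]) hiter
  have hquarter : ∀ w ∈ α, f (ψ w.1) = ψ w.1 + Real.pi / 2 := by
    intro w hw
    obtain ⟨z, hz, rfl, hzα, -⟩ := hper w hw
    have hf_step : ∀ n, f (ψ (z n).1) = ψ (z (n + 1)).1 := fun n => hstep _ (hzα n) _ (hz n)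
    have hhalf_step : ∀ n, ψ (z (n + 1 + 1)).1 = ψ (z n).1 + Real.pi := fun n => by
      rw [← hf_step, ← hf_step, hhalf]
    rw [hf_step]
    exact (hz 0).angle_eq_add_pi_div_two hγ hψ (hz _) (hz _) (hhalf_step _) (hhalf_step _)
  refine ⟨f, hf, fun x => ?_, hstep, hsurj⟩
  obtain ⟨w, hw, rfl⟩ := hsurj x
  exact hquarter w hw

end Billiard

/-! ### Quarter turns -/

theorem height_supportCurve_add_pi_div_two (h : ℝ → ℝ) (x : ℝ) :
    height x (supportCurve h (x + Real.pi / 2)) = -deriv h (x + Real.pi / 2) := by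
  rw [← height_add_pi_div_two_supportCurve, add_assoc, add_halves, height_add_pi, neg_neg]

theorem chordCot_add_pi_div_two (h : ℝ → ℝ) (x : ℝ) :
    chordCot h x (x + Real.pi / 2) =
      (h (x + Real.pi / 2) - deriv h x) / (h x + deriv h (x + Real.pi / 2)) := by
  rw [chordCot, map_sub, map_sub, height_supportCurve, height_supportCurve,
    height_add_pi_div_two_supportCurve, height_supportCurve_add_pi_div_two, sub_neg_eq_add]

namespace IsOvalSupport

variable {h : ℝ → ℝ}

theorem supportCurve_sub_pi_div_two (hh : IsOvalSupport h) (x : ℝ) :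
    supportCurve h (x - Real.pi / 2) = -supportCurve h (x + Real.pi / 2) := by
  rw [← hh.supportCurve_antiperiodic.sub_eq]
  congr 1
  ring

theorem chordCot_sub_pi_div_two (hh : IsOvalSupport h) (x : ℝ) :
    chordCot h x (x - Real.pi / 2) =
      (-h (x + Real.pi / 2) - deriv h x) / (h x - deriv h (x + Real.pi / 2)) := by
  rw [chordCot, hh.supportCurve_sub_pi_div_two, map_sub, map_sub, map_neg, map_neg,
    height_supportCurve, height_supportCurve, height_add_pi_div_two_supportCurve,
    height_supportCurve_add_pi_div_two, neg_neg]

theorem add_deriv_pos (hh : IsOvalSupport h) (x : ℝ) : 0 < h x + deriv h (x + Real.pi / 2) := by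
  have hpos := hh.height_sub_pos (x := x) (y := x + Real.pi / 2) (by linarith [Real.pi_pos])
    (by linarith [Real.pi_pos])
  rwa [map_sub, height_supportCurve, height_supportCurve_add_pi_div_two, sub_neg_eq_add] at hpos

theorem mul_deriv_add_mul_deriv_eq_zero (hh : IsOvalSupport h) {x : ℝ}
    (hK : chordCot h x (x + Real.pi / 2) + chordCot h x (x - Real.pi / 2) = 0) :
    h x * deriv h x + h (x + Real.pi / 2) * deriv h (x + Real.pi / 2) = 0 := by
  have hright := hh.add_deriv_pos x
  have hleft : 0 < h x - deriv h (x + Real.pi / 2) := by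
    have hpos := hh.height_sub_pos (x := x) (y := x - Real.pi / 2 + 2 * Real.pi)
      (by linarith [Real.pi_pos]) (by linarith [Real.pi_pos])
    rwa [supportCurve_periodic_two_pi hh.periodic_two_pi, hh.supportCurve_sub_pi_div_two, map_sub,
      map_neg, height_supportCurve, height_supportCurve_add_pi_div_two, neg_neg] at hpos
  rw [chordCot_add_pi_div_two, hh.chordCot_sub_pi_div_two,
    div_add_div _ _ hright.ne' hleft.ne', div_eq_zero_iff,
    or_iff_left (mul_pos hright hleft).ne'] at hK
  linear_combination (-1 / 2) * hK

theorem chordCot_add_pi_div_two_eq_div (hh : IsOvalSupport h) {x : ℝ}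
    (hK : chordCot h x (x + Real.pi / 2) + chordCot h x (x - Real.pi / 2) = 0) :
    chordCot h x (x + Real.pi / 2) = h (x + Real.pi / 2) / h x := by
  rw [chordCot_add_pi_div_two, div_eq_div_iff (hh.add_deriv_pos x).ne' (hh.pos x).ne']
  linear_combination -hh.mul_deriv_add_mul_deriv_eq_zero hK

theorem exists_sq_add_sq_eq (hh : IsOvalSupport h)
    (hK : ∀ x, chordCot h x (x + Real.pi / 2) + chordCot h x (x - Real.pi / 2) = 0) :
    ∃ R > 0, ∀ x, h x ^ 2 + h (x + Real.pi / 2) ^ 2 = R ^ 2 := by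
  set F : ℝ → ℝ := fun x => h x ^ 2 + h (x + Real.pi / 2) ^ 2
  have hF : ∀ x, HasDerivAt F 0 x := fun x => by
    refine (((hh.hasDerivAt x).fun_pow 2).fun_add
      (((hh.hasDerivAt _).comp_add_const x (Real.pi / 2)).fun_pow 2)).congr_deriv ?_
    linear_combination 2 * hh.mul_deriv_add_mul_deriv_eq_zero (hK x)
  have hpos : 0 < F 0 := add_pos (pow_pos (hh.pos _) 2) (pow_pos (hh.pos _) 2)
  refine ⟨√(F 0), Real.sqrt_pos.2 hpos, fun x => ?_⟩
  rw [Real.sq_sqrt hpos.le]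
  exact is_const_of_deriv_eq_zero (fun x => (hF x).differentiableAt) (fun x => (hF x).deriv) x 0

end IsOvalSupport

theorem cot_arcsin_div {a b R : ℝ} (hb : 0 ≤ b) (hR : 0 < R) (h : a ^ 2 + b ^ 2 = R ^ 2) :
    Real.cot (Real.arcsin (a / R)) = b / a := by
  have hle : a ≤ R := abs_le_of_sq_le_sq' (by nlinarith) hR.le |>.2
  have hge : -R ≤ a := abs_le_of_sq_le_sq' (by nlinarith) hR.le |>.1
  have hsqrt : √(1 - (a / R) ^ 2) = b / R := by
    rw [← Real.sqrt_sq (div_nonneg hb hR.le)]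
    congr 1
    field_simp
    linarith
  rw [Real.cot_eq_cos_div_sin, Real.cos_arcsin, hsqrt,
    Real.sin_arcsin ((le_div_iff₀ hR).2 (by linarith)) ((div_le_one hR).2 hle),
    div_div_div_cancel_right₀ hR.ne']

theorem IsTable.exists_radius {γ : ℝ → ℂ} {P : ℝ} {ψ : ℝ ≃o ℝ} {α : Set (ℝ × ℝ)}
    (hγ : IsTable γ P) (hψ : IsNormalAngle γ ψ)
    (hα : IsRotationalCurve P α) (hper : ConsistsOfPeriodicOrbits γ P 4 α)
    (hrot : HasRotationNumber γ P α (1 / 4)) :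
    ∃ R > 0, (∀ x, supportFunction γ x ^ 2 + supportFunction γ (x + Real.pi / 2) ^ 2 = R ^ 2) ∧
      α = {w | w.2 = Real.arcsin (supportFunction γ (ψ w.1) / R)} := by
  have hh := hγ.isOvalSupport
  obtain ⟨f, hf, hquarter, hstep, hsurj⟩ := hγ.exists_quarter_turn hψ hα hper hrot
  have hK : ∀ x, chordCot (supportFunction γ) x (x + Real.pi / 2) +
      chordCot (supportFunction γ) x (x - Real.pi / 2) = 0 := fun x => by
    have hsymm : f.symm x = x - Real.pi / 2 := by
      rw [f.symm_apply_eq, hquarter, sub_add_cancel]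
    rw [← hquarter, ← hsymm]
    exact hf.reflect x
  obtain ⟨R, hR, horth⟩ := hh.exists_sq_add_sq_eq hK
  have hgraph : ∀ w ∈ α, w.2 = Real.arcsin (supportFunction γ (ψ w.1) / R) := fun w hw => by
    obtain ⟨z, hz, rfl, -⟩ := hper w hw
    have harcsin := (isQuarterAngle_arcsin hh.contDiff hh.pos hR horth).mem_Ioo (ψ (z 0).1)
    refine injOn_cot (hz 0).1 ⟨harcsin.1, harcsin.2.trans (half_lt_self Real.pi_pos)⟩ ?_
    rw [cot_arcsin_div (hh.pos _).le hR (horth _), ← hh.chordCot_add_pi_div_two_eq_div (hK _),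
      ← hquarter, hstep _ hw _ (hz 0), (hz 0).chordCot_right hγ hψ]
  refine ⟨R, hR, horth, Subset.antisymm hgraph fun w hw => ?_⟩
  obtain ⟨w', hw', hfst⟩ := hsurj (ψ w.1)
  have hsnd : w'.2 = w.2 := by rw [hgraph w' hw', hfst, ← (show w.2 = _ from hw)]
  rwa [← Prod.ext (ψ.injective hfst) hsnd]

/-! ### The domain between the invariant curve and its reversal -/

theorem pos_of_joinedIn {X : Type*} [TopologicalSpace X] {S : Set X} {g : X → ℝ}
    (hg : ContinuousOn g S) (hne : ∀ x ∈ S, g x ≠ 0) {x y : X} (h : JoinedIn S x y)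
    (hy : 0 < g y) : 0 < g x := by
  by_contra! hx
  have hpath : Continuous (g ∘ h.somePath) :=
    hg.comp_continuous h.somePath.continuous h.somePath_mem
  obtain ⟨t, ht⟩ := mem_range_of_exists_le_of_exists_ge hpath (c := 0)
    ⟨0, by rwa [Function.comp_apply, h.somePath.source]⟩
    ⟨1, by rw [Function.comp_apply, h.somePath.target]; exact hy.le⟩
  exact hne _ (h.somePath_mem t) ht

theorem joinedIn_of_forall_uIcc {S : Set (ℝ × ℝ)} {s a b : ℝ} (h : ∀ y ∈ uIcc a b, (s, y) ∈ S) :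
    JoinedIn S (s, a) (s, b) := by
  refine JoinedIn.of_segment_subset ?_
  rw [← Prod.image_mk_segment_right, segment_eq_uIcc]
  exact image_subset_iff.2 h

theorem upperSide_graph {d : ℝ → ℝ} (hd : Continuous d) (h0 : ∀ s, 0 ≤ d s)
    (hπ : ∀ s, d s < Real.pi) :
    upperSide {w : ℝ × ℝ | w.2 = d w.1} = {w | w.2 ∈ Ioc (d w.1) Real.pi} := by
  ext ⟨s, δ⟩
  refine ⟨fun ⟨t, h⟩ => ⟨sub_pos.1 ?_, h.source_mem.1.2.2⟩, fun hδ => ⟨s, ?_⟩⟩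
  · exact pos_of_joinedIn (g := fun w => w.2 - d w.1) (by fun_prop)
      (fun w hw => sub_ne_zero.2 hw.2) h (sub_pos.2 (hπ t))
  · refine joinedIn_of_forall_uIcc fun y hy => ?_
    rw [uIcc_of_le hδ.2] at hy
    have hlt : d s < y := hδ.1.trans_le hy.1
    exact ⟨⟨mem_univ _, (h0 s).trans_lt hlt, hy.2⟩, hlt.ne'⟩

theorem lowerSide_graph {d : ℝ → ℝ} (hd : Continuous d) (h0 : ∀ s, 0 < d s)
    (hπ : ∀ s, d s ≤ Real.pi) :
    lowerSide {w : ℝ × ℝ | w.2 = d w.1} = {w | w.2 ∈ Ico 0 (d w.1)} := by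
  ext ⟨s, δ⟩
  refine ⟨fun ⟨t, h⟩ => ⟨h.source_mem.1.2.1, sub_pos.1 ?_⟩, fun hδ => ⟨s, ?_⟩⟩
  · exact pos_of_joinedIn (g := fun w => d w.1 - w.2) (by fun_prop)
      (fun w hw => sub_ne_zero.2 (Ne.symm hw.2)) h (sub_pos.2 (h0 t))
  · refine joinedIn_of_forall_uIcc fun y hy => ?_
    rw [uIcc_of_ge hδ.1] at hy
    have hlt : y < d s := hy.2.trans_lt hδ.2
    exact ⟨⟨mem_univ _, hy.1, hlt.trans_le (hπ s)⟩, hlt.ne⟩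

section Region

variable {γ : ℝ → ℂ} {P : ℝ} {α : Set (ℝ × ℝ)} {N : ℕ}

theorem reversed_eq (hinv : IsInvariant γ P α) (hper : ConsistsOfPeriodicOrbits γ P N α) :
    reversed γ P α = {w | (w.1, Real.pi - w.2) ∈ α} := by
  ext w
  refine ⟨?_, fun hw => ?_⟩
  · rintro ⟨z, hz, z₁, hstep, rfl⟩
    simpa only [mem_ofPred_eq, sub_sub_cancel] using (hinv z z₁ hstep).1 hz
  · obtain ⟨z, hz, hz₀, hzα, -⟩ := hper _ hw
    have hstep := hz (-1)
    rw [neg_add_cancel, hz₀] at hstep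
    exact ⟨z (-1), hzα _, _, hstep, Prod.ext rfl (sub_sub_cancel _ _).symm⟩

theorem regionBetween_eq {d : ℝ → ℝ} (hd : Continuous d)
    (hmem : ∀ s, d s ∈ Ioo 0 (Real.pi / 2)) (hinv : IsInvariant γ P α)
    (hper : ConsistsOfPeriodicOrbits γ P N α) (hα : α = {w | w.2 = d w.1}) :
    regionBetween γ P α = {w | w.2 ∈ Ioo (d w.1) (Real.pi - d w.1)} := by
  have hrev : reversed γ P α = {w | w.2 = Real.pi - d w.1} := by
    rw [reversed_eq hinv hper, hα]
    ext w
    simp only [mem_ofPred_eq]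
    exact ⟨fun h => by linarith, fun h => by linarith⟩
  have hd' : Continuous fun s => Real.pi - d s := by fun_prop
  rw [regionBetween, hrev, hα,
    upperSide_graph hd (fun s => (hmem s).1.le) fun s => by linarith [(hmem s).2, Real.pi_pos],
    lowerSide_graph hd' (fun s => by linarith [(hmem s).2, Real.pi_pos])
      fun s => by linarith [(hmem s).1]]
  ext w
  refine ⟨fun h => ⟨h.1.1, h.2.2⟩, fun h => ⟨⟨h.1, ?_⟩, ?_, h.2⟩⟩ <;>
    linarith [(hmem w.1).1, h.1, h.2]

end Region

/-! ### The integral over the domain -/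

theorem integral_sin_sq_eq_wedge {θ : ℝ} (hθ : θ ≤ Real.pi / 2) :
    ∫ δ in Ioo θ (Real.pi - θ), Real.sin δ ^ 2 = wedge θ := by
  rw [← integral_Ioc_eq_integral_Ioo, ← intervalIntegral.integral_of_le (by linarith),
    integral_sin_sq, Real.sin_pi_sub, Real.cos_pi_sub, wedge]
  ring

theorem integrable_invMeasure (P : ℝ) {f : ℝ × ℝ → ℝ} (hf : Continuous f) :
    Integrable f (invMeasure P) := by
  have hmeas : Measurable fun z : ℝ × ℝ => ENNReal.ofReal (Real.sin z.2) := by fun_prop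
  rw [invMeasure, integrable_withDensity_iff_integrable_smul' hmeas
    (Eventually.of_forall fun _ => ENNReal.ofReal_lt_top)]
  simp only [ENNReal.toReal_ofReal']
  have hcompact : IsCompact (Icc 0 P ×ˢ Icc 0 Real.pi) := isCompact_Icc.prod isCompact_Icc
  exact ((by fun_prop : Continuous _).continuousOn.integrableOn_compact hcompact).mono_set
    (prod_mono Ico_subset_Icc_self Ioo_subset_Icc_self)

theorem setIntegral_invMeasure {P : ℝ} (hP : 0 ≤ P) {f : ℝ × ℝ → ℝ} (hf : Continuous f)
    {B : Set (ℝ × ℝ)} (hB : MeasurableSet B) :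
    ∫ z in B, f z ∂(invMeasure P) =
      ∫ s in 0..P, ∫ δ in Ioo 0 Real.pi ∩ Prod.mk s ⁻¹' B, Real.sin δ * f (s, δ) := by
  have hmeas : Measurable fun z : ℝ × ℝ => ENNReal.ofReal (Real.sin z.2) := by fun_prop
  have hint : IntegrableOn (fun z : ℝ × ℝ => (ENNReal.ofReal (Real.sin z.2)).toReal • f z)
      (Ico 0 P ×ˢ Ioo 0 Real.pi) :=
    (integrable_withDensity_iff_integrable_smul' hmeas
      (Eventually.of_forall fun _ => ENNReal.ofReal_lt_top)).1 (integrable_invMeasure P hf)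
  rw [Measure.volume_eq_prod] at hint
  rw [invMeasure, setIntegral_withDensity_eq_setIntegral_toReal_smul hmeas
      (Eventually.of_forall fun _ => ENNReal.ofReal_lt_top) _ hB, ← integral_indicator hB,
    Measure.volume_eq_prod, setIntegral_prod _ (hint.indicator hB), integral_Ico_eq_integral_Ioo,
    ← integral_Ioc_eq_integral_Ioo, ← intervalIntegral.integral_of_le hP]
  refine intervalIntegral.integral_congr fun s _ => ?_
  have hBs : MeasurableSet (Prod.mk s ⁻¹' B) := measurable_prodMk_left hB
  calc ∫ δ in Ioo 0 Real.pi,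
        B.indicator (fun z => (ENNReal.ofReal (Real.sin z.2)).toReal • f z) (s, δ)
      = ∫ δ in Ioo 0 Real.pi, (Prod.mk s ⁻¹' B).indicator
          (fun δ => (ENNReal.ofReal (Real.sin δ)).toReal • f (s, δ)) δ := rfl
    _ = ∫ δ in Ioo 0 Real.pi ∩ Prod.mk s ⁻¹' B,
          (ENNReal.ofReal (Real.sin δ)).toReal • f (s, δ) := setIntegral_indicator hBs
    _ = _ := setIntegral_congr_fun (measurableSet_Ioo.inter hBs) fun δ hδ => by
          rw [ENNReal.toReal_ofReal (Real.sin_pos_of_mem_Ioo hδ.1).le, smul_eq_mul]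

theorem setIntegral_invMeasure_graph {P : ℝ} (hP : 0 ≤ P) {g d : ℝ → ℝ} (hg : Continuous g)
    (hd : Continuous d) (hmem : ∀ s, d s ∈ Ioo 0 (Real.pi / 2)) :
    ∫ z in {w : ℝ × ℝ | w.2 ∈ Ioo (d w.1) (Real.pi - d w.1)}, g z.1 * Real.sin z.2
      ∂(invMeasure P) = ∫ s in 0..P, g s * wedge (d s) := by
  have hB : IsOpen {w : ℝ × ℝ | w.2 ∈ Ioo (d w.1) (Real.pi - d w.1)} :=
    (isOpen_lt (by fun_prop) continuous_snd).inter (isOpen_lt continuous_snd (by fun_prop))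
  rw [setIntegral_invMeasure hP (by fun_prop) hB.measurableSet]
  refine intervalIntegral.integral_congr fun s _ => ?_
  have hinter : Ioo 0 Real.pi ∩ Ioo (d s) (Real.pi - d s) = Ioo (d s) (Real.pi - d s) :=
    inter_eq_right.2 (Ioo_subset_Ioo (hmem s).1.le (by linarith [(hmem s).1]))
  calc ∫ δ in Ioo 0 Real.pi ∩ Ioo (d s) (Real.pi - d s), Real.sin δ * (g s * Real.sin δ)
      = ∫ δ in Ioo (d s) (Real.pi - d s), g s * Real.sin δ ^ 2 := by
        rw [hinter]
        exact integral_congr_ae (Eventually.of_forall fun δ => by ring)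
    _ = g s * wedge (d s) := by
        rw [integral_const_mul, integral_sin_sq_eq_wedge (hmem s).2.le]

section Table

variable {γ : ℝ → ℂ} {P : ℝ} {ψ : ℝ ≃o ℝ}

theorem IsTable.periodic_deriv_deriv_supportFunction (hγ : IsTable γ P) :
    Function.Periodic (deriv (deriv (supportFunction γ))) (2 * Real.pi) :=
  deriv_periodic (deriv_periodic hγ.isOvalSupport.periodic_two_pi)

theorem IsTable.integrand_eq (hγ : IsTable γ P) (hψ : IsNormalAngle γ ψ) :
    integrand γ = fun z => deriv (deriv (supportFunction γ)) (ψ z.1) * Real.sin z.2 := by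
  ext z
  have hangle : normalAngle γ z.1 = toIocMod Real.two_pi_pos (-Real.pi) (ψ z.1) := by
    rw [normalAngle, (hψ.hasDerivAt_curve z.1).deriv, neg_mul, ← mul_assoc, Complex.I_mul_I,
      neg_one_mul, neg_neg, Complex.arg_exp_mul_I]
  rw [integrand, hangle, toIocMod, hγ.periodic_deriv_deriv_supportFunction.sub_zsmul_eq]

theorem IsTable.hasDerivAt_angle_symm_support (hγ : IsTable γ P) (hψ : IsNormalAngle γ ψ) (x : ℝ) :
    HasDerivAt ψ.symm (supportFunction γ x + deriv (deriv (supportFunction γ)) x) x :=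
  hγ.inv_curvature_eq hψ x ▸ hγ.hasDerivAt_angle_symm hψ x

theorem IsTable.angle_symm_add_two_pi (hγ : IsTable γ P) (hψ : IsNormalAngle γ ψ) (x : ℝ) :
    ψ.symm (x + 2 * Real.pi) = ψ.symm x + P := by
  rw [ψ.symm_apply_eq, hγ.angle_add_period hψ, ψ.apply_symm_apply]

theorem IsTable.integral_supportFunction (hγ : IsTable γ P) :
    ∫ x in 0..2 * Real.pi, supportFunction γ x = P := by
  obtain ⟨ψ, hψ⟩ := hγ.exists_isNormalAngle
  have hh := hγ.isOvalSupport
  have hsymm := intervalIntegral.integral_eq_sub_of_hasDerivAt (a := 0) (b := 2 * Real.pi)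
    (fun x _ => hγ.hasDerivAt_angle_symm_support hψ x)
    ((hh.continuous.add hh.continuous_deriv_deriv).intervalIntegrable _ _)
  have hderiv := intervalIntegral.integral_eq_sub_of_hasDerivAt (a := 0) (b := 2 * Real.pi)
    (fun x _ => hh.hasDerivAt_deriv x) (hh.continuous_deriv_deriv.intervalIntegrable _ _)
  rw [(deriv_periodic hh.periodic_two_pi).eq, sub_self] at hderiv
  rwa [intervalIntegral.integral_add (hh.continuous.intervalIntegrable _ _)
    (hh.continuous_deriv_deriv.intervalIntegrable _ _), hderiv, add_zero,
    ← zero_add (2 * Real.pi), hγ.angle_symm_add_two_pi hψ, add_sub_cancel_left, zero_add] at hsymm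

theorem IsTable.integral_comp_angle (hγ : IsTable γ P) (hψ : IsNormalAngle γ ψ) {g : ℝ → ℝ}
    (hg : Continuous g) (hper : Function.Periodic g (2 * Real.pi)) :
    ∫ s in 0..P, g (ψ s) = ∫ x in 0..2 * Real.pi,
      g x * (supportFunction γ x + deriv (deriv (supportFunction γ)) x) := by
  have hh := hγ.isOvalSupport
  have hsubst := intervalIntegral.integral_comp_mul_deriv (a := ψ 0) (b := ψ 0 + 2 * Real.pi)
    (g := fun s => g (ψ s)) (fun x _ => hγ.hasDerivAt_angle_symm_support hψ x)
    (hh.continuous.add hh.continuous_deriv_deriv).continuousOn (hg.comp hψ.continuous)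
  have hperiodic := (hper.mul (hh.periodic_two_pi.add
    hγ.periodic_deriv_deriv_supportFunction)).intervalIntegral_add_eq (ψ 0) 0
  simp only [Function.comp_apply, ψ.apply_symm_apply, hγ.angle_symm_add_two_pi hψ,
    ψ.symm_apply_apply, zero_add] at hsubst
  rw [zero_add] at hperiodic
  exact hsubst.symm.trans hperiodic

theorem IsTable.integrable_integrand (hγ : IsTable γ P) :
    Integrable (integrand γ) (invMeasure P) := by
  obtain ⟨ψ, hψ⟩ := hγ.exists_isNormalAngle
  rw [hγ.integrand_eq hψ]
  exact integrable_invMeasure P (((hγ.isOvalSupport.continuous_deriv_deriv.comp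
    hψ.continuous).comp continuous_fst).mul (by fun_prop))

theorem IsTable.setIntegral_integrand (hγ : IsTable γ P) (hψ : IsNormalAngle γ ψ) {d : ℝ → ℝ}
    (hd : Continuous d) (hper : Function.Periodic d (2 * Real.pi))
    (hmem : ∀ x, d x ∈ Ioo 0 (Real.pi / 2)) :
    ∫ z in {w | w.2 ∈ Ioo (d (ψ w.1)) (Real.pi - d (ψ w.1))}, integrand γ z ∂(invMeasure P) =
      ∫ x in 0..2 * Real.pi, deriv (deriv (supportFunction γ)) x *
        (supportFunction γ x + deriv (deriv (supportFunction γ)) x) * wedge (d x) := by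
  have hdd := hγ.isOvalSupport.continuous_deriv_deriv
  rw [hγ.integrand_eq hψ]
  refine (setIntegral_invMeasure_graph hγ.pos.le (hdd.comp hψ.continuous)
    (hd.comp hψ.continuous) fun s => hmem (ψ s)).trans ?_
  refine (hγ.integral_comp_angle hψ (hdd.mul (continuous_wedge.comp hd))
    (hγ.periodic_deriv_deriv_supportFunction.mul (hper.comp wedge))).trans ?_
  exact intervalIntegral.integral_congr fun x _ => mul_right_comm _ _ _

theorem IsTable.isoperimetric_deficit_le (hγ : IsTable γ P) :
    P ^ 2 - 4 * Real.pi * area γ ≤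
      (∫ x in 0..2 * Real.pi, supportFunction γ x) ^ 2 - 2 * Real.pi *
        ∫ x in 0..2 * Real.pi, supportFunction γ x *
          (supportFunction γ x + deriv (deriv (supportFunction γ)) x) := by
  have harea := mul_le_mul_of_nonneg_left hγ.half_integral_le_area
    (by positivity : 0 ≤ 4 * Real.pi)
  rw [hγ.integral_supportFunction]
  linarith

end Table

end Billiard

end

theorem mainTheorem5_general (γ : ℝ → ℂ) (P : ℝ) (hγ : Billiard.IsTable γ P)
    (α : Set (ℝ × ℝ)) (hα : Billiard.IsRotationalCurve P α)
    (hinv : Billiard.IsInvariant γ P α)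
    (hper : Billiard.ConsistsOfPeriodicOrbits γ P 4 α)
    (hrot : Billiard.HasRotationNumber γ P α (1 / 4))
    (c : ℝ) (hc₀ : 0 ≤ c) (hc : c ≤ 1 / 4 + 1 / Real.pi) :
    ContDiff ℝ 2 (Billiard.supportFunction γ) ∧
    IntegrableOn (Billiard.integrand γ) (Billiard.regionBetween γ P α) (Billiard.invMeasure P) ∧
    c * (P ^ 2 - 4 * Real.pi * Billiard.area γ) ≤
      ∫ z in Billiard.regionBetween γ P α, Billiard.integrand γ z ∂(Billiard.invMeasure P) := by
  obtain ⟨ψ, hψ⟩ := hγ.exists_isNormalAngle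
  obtain ⟨R, hR, horth, hgraph⟩ := hγ.exists_radius hψ hα hper hrot
  have hh := hγ.isOvalSupport
  have hangle := Billiard.isQuarterAngle_arcsin hh.contDiff hh.pos hR horth
  have hcont := hangle.contDiff.continuous
  refine ⟨hh.contDiff, hγ.integrable_integrand.integrableOn, ?_⟩
  rw [Billiard.regionBetween_eq (hcont.comp hψ.continuous) (fun _ => hangle.mem_Ioo _) hinv hper
    hgraph]
  calc c * (P ^ 2 - 4 * Real.pi * Billiard.area γ)
      ≤ _ := mul_le_mul_of_nonneg_left hγ.isoperimetric_deficit_le hc₀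
    _ ≤ _ := Billiard.orthoptic_inequality hh.contDiff hh.pos hR horth hc₀ hc
    _ = _ := (hγ.setIntegral_integrand hψ hcont
        (hh.periodic_two_pi.comp fun y => Real.arcsin (y / R)) hangle.mem_Ioo).symm

theorem mainTheorem5 (γ : ℝ → ℂ) (P : ℝ) (hγ : Billiard.IsTable γ P)
    (α : Set (ℝ × ℝ)) (hα : Billiard.IsRotationalCurve P α)
    (hinv : Billiard.IsInvariant γ P α)
    (hper : Billiard.ConsistsOfPeriodicOrbits γ P 4 α)
    (hrot : Billiard.HasRotationNumber γ P α (1 / 4)) :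
    ContDiff ℝ 2 (Billiard.supportFunction γ) ∧
    IntegrableOn (Billiard.integrand γ) (Billiard.regionBetween γ P α) (Billiard.invMeasure P) ∧
    3 / 8 * (P ^ 2 - 4 * Real.pi * Billiard.area γ) ≤
      ∫ z in Billiard.regionBetween γ P α, Billiard.integrand γ z ∂(Billiard.invMeasure P) := by
  have hpi : 1 / 8 ≤ 1 / Real.pi :=
    one_div_le_one_div_of_le Real.pi_pos (by linarith [Real.pi_lt_four])
  exact mainTheorem5_general γ P hγ α hα hinv hper hrot _ (by norm_num) (by linarith)
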